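/- Let $(\Omega,\mathcal F,\mathbb P)$ be a probability space, $\Xi$ a measurable space, $\xi$ a $\Xi$-valued random variable with law $\mu$, and $f:\mathbb R^d\times\Xi\to\mathbb R$ a measurable map such that $f(\cdot,s)$ is differentiable for every $s\in\Xi$; write $\nabla f(x,s)$ for its gradient in $x$. For $u\in\mathbb R^d$, $u^{\odot 2}$ is the vector with coordinates $u_i^2$; divisions and square roots of vectors are taken coordinatewise. Assume: 1. For $\mu$-almost every $s$, $f(\cdot,s)$ is continuously differentiable; there is $x_*\in\mathbb R^d$ with $\mathbb E|f(x_*,\xi)|<\infty$ and $\mathbb E\|\nabla f(x_*,\xi)\|^2<\infty$; and for every compact $K\subset\mathbb R^d$ there is $L_K>0$ such that $\mathbb E\|\nabla f(x,\xi)-\nabla f(y,\xi)\|^2\le L_K^2\|x-y\|^2$ for all $x,y\in K$. 2. Put $F(x)=\mathbb E f(x,\xi)$, $S(x)=\mathbb E[\nabla f(x,\xi)^{\odot 2}]$ and $\mathcal S=\{x:\nabla F(x)=0\}$. $F$ is coercive, that is, $F(x)\to+\infty$ as $\|x\|\to\infty$; for every $x$ all coordinates of $S(x)$ are positive; and the set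 $F(\mathcal S)\subset\mathbb R$ has empty interior. 3. For every compact $K\subset\mathbb R^d$, $\sup_{x\in K}\mathbb E\|\nabla f(x,\xi)\|^4<\infty$. 4. $(\xi_n)_{n\ge1}$ are i.i.d. random variables on $\Omega$ with the law of $\xi$. 5. $\gamma_n>0$ and $\alpha_n,\beta_n\in[0,1]$ for all $n\ge1$; $\gamma_{n+1}/\gamma_n\to1$; $\sum_n\gamma_n=+\infty$, $\sum_n\gamma_n^2<\infty$; and there are $a,b$ with $0<b<4a$ such that $(1-\alpha_n)/\gamma_n\to a$ and $(1-\beta_n)/\gamma_n\to b$. Let $\varepsilon>0$, $x_0\in\mathbb R^d$, $m_0=v_0=0\in\mathbb R^d$, $r_0=\bar r_0=0\in\mathbb R$, and define for $n\ge1$ $$m_n=\alpha_nm_{n-1}+(1-\alpha_n)\nabla f(x_{n-1},\xi_n),\qquad v_n=\beta_nv_{n-1}+(1-\beta_n)\nabla f(x_{n-1},\xi_n)^{\odot2},$$ $$r_n=\alpha_nr_{n-1}+(1-\alpha_n),\qquad \bar r_n=\beta_n\bar r_{n-1}+(1-\beta_n),$$ $$\hat m_n=m_n/r_n,\qquad \hat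 v_n=v_n/\bar r_n,\qquad x_n=x_{n-1}-\gamma_n\,\frac{\hat m_n}{\varepsilon+\sqrt{\hat v_n}},$$ where $0/0$ is read as $0$ (this occurs only if $\alpha_1=\dots=\alpha_n=1$, resp. $\beta_1=\dots=\beta_n=1$). Suppose that, with probability one, the sequence $z_n=(x_n,m_n,v_n)$ is bounded. Then $\mathcal S$ is non-empty and, with probability one, $\lim_{n\to\infty}\inf_{y\in\mathcal S}\|x_n-y\|=0$, $\lim_{n\to\infty}m_n=0$ and $\lim_{n\to\infty}(S(x_n)-v_n)=0$. If moreover $\mathcal S$ is finite or countable, then with probability one there exists $x^*\in\mathcal S$ such that $\lim_{n\to\infty}z_n=(x^*,0,S(x^*))$. -/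

import Mathlib

open Filter Topology MeasureTheory ProbabilityTheory
open scoped ENNReal

namespace DecrAdam

/-- The Euclidean space `ℝ^d`. -/
abbrev Vec (d : ℕ) : Type := EuclideanSpace ℝ (Fin d)

variable {d : ℕ} {Ξ : Type*}

/-- `∇f(x, s)`: the gradient of `f(·, s)` at `x`. -/
noncomputable def grad (f : Vec d → Ξ → ℝ) (x : Vec d) (s : Ξ) : Vec d :=
  gradient (fun y => f y s) x

/-- The objective `F(x) = E f(x, ξ)`, where `μ` is the law of `ξ`. -/
noncomputable def F [MeasurableSpace Ξ] (f : Vec d → Ξ → ℝ) (μ : Measure Ξ) (x : Vec d) : ℝ :=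
  ∫ s, f x s ∂μ

/-- `S(x) = E (∇f(x, ξ)^{⊙2})`, the vector of coordinatewise second moments. -/
noncomputable def S [MeasurableSpace Ξ] (f : Vec d → Ξ → ℝ) (μ : Measure Ξ) (x : Vec d) : Vec d :=
  WithLp.toLp 2 fun i => ∫ s, (grad f x s i) ^ 2 ∂μ

/-- The set of critical points of `F`. -/
noncomputable def crit [MeasurableSpace Ξ] (f : Vec d → Ξ → ℝ) (μ : Measure Ξ) : Set (Vec d) :=
  gradient (F f μ) ⁻¹' {0}

/-- The regularity assumptions on the random cost `f(x, ξ)`, where `ξ` has law `μ`. The second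
moments are lower Lebesgue integrals, so the bounds below include their finiteness. -/
structure Model [MeasurableSpace Ξ] (f : Vec d → Ξ → ℝ) (μ : Measure Ξ) : Prop where
  measurable : Measurable fun q : Vec d × Ξ => f q.1 q.2
  differentiable : ∀ s, Differentiable ℝ fun x => f x s
  contDiff : ∀ᵐ s ∂μ, ContDiff ℝ 1 fun x => f x s
  exists_point : ∃ x, Integrable (f x) μ ∧ ∫⁻ s, ‖grad f x s‖ₑ ^ 2 ∂μ < ∞
  lipschitz : ∀ K : Set (Vec d), IsCompact K → ∃ L : ℝ, 0 < L ∧ ∀ x ∈ K, ∀ y ∈ K,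
    ∫⁻ s, ‖grad f x s - grad f y s‖ₑ ^ 2 ∂μ ≤ ENNReal.ofReal (L ^ 2 * ‖x - y‖ ^ 2)

/-- `sup_{x ∈ K} E ‖∇f(x, ξ)‖^p < ∞` for every compact set `K`. -/
def LocMoment [MeasurableSpace Ξ] (f : Vec d → Ξ → ℝ) (μ : Measure Ξ) (p : ℝ) : Prop :=
  ∀ K : Set (Vec d), IsCompact K → (⨆ x ∈ K, ∫⁻ s, ‖grad f x s‖ₑ ^ p ∂μ) < ∞

/-- `ξ 1, ξ 2, …` are independent random variables with common law `μ` (`ξ 0` plays no role). -/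
structure IsIIDSample {Ω : Type*} [MeasurableSpace Ω] [MeasurableSpace Ξ] (P : Measure Ω)
    (μ : Measure Ξ) (ξ : ℕ → Ω → Ξ) : Prop where
  measurable : ∀ n ≥ 1, Measurable (ξ n)
  map_eq : ∀ n ≥ 1, P.map (ξ n) = μ
  indep : iIndepFun (fun n => ξ (n + 1)) P

/-- The assumptions on the hyperparameters `(γ n, α n, β n)`, `n ≥ 1` (index `0` plays no role). -/
structure Stepsizes (γ α β : ℕ → ℝ) : Prop where
  pos : ∀ n ≥ 1, 0 < γ n
  ratio : Tendsto (fun n => γ (n + 1) / γ n) atTop (𝓝 1)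
  sum_eq_top : Tendsto (fun N => ∑ n ∈ Finset.Icc 1 N, γ n) atTop atTop
  summable_sq : Summable fun n => γ (n + 1) ^ 2
  alpha_mem : ∀ n ≥ 1, 0 ≤ α n ∧ α n ≤ 1
  beta_mem : ∀ n ≥ 1, 0 ≤ β n ∧ β n ≤ 1
  limits : ∃ a b : ℝ, 0 < b ∧ b < 4 * a ∧
    Tendsto (fun n => (γ n)⁻¹ * (1 - α n)) atTop (𝓝 a) ∧
    Tendsto (fun n => (γ n)⁻¹ * (1 - β n)) atTop (𝓝 b)

/-- The variables `(x, m, v, r, r̄)` updated by the algorithm. -/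
structure State (d : ℕ) where
  x : Vec d
  m : Vec d
  v : Vec d
  r : ℝ
  rbar : ℝ

/-- One iteration of the algorithm. As long as `r = 0` (resp. `rbar = 0`), also `m = 0`
(resp. `v = 0`), and the quotient `m / r` (resp. `v / rbar`) is read as `0`. -/
noncomputable def step (f : Vec d → Ξ → ℝ) (ε γ α β : ℝ) (z : State d) (s : Ξ) : State d :=
  let g := grad f z.x s
  let m : Vec d := α • z.m + (1 - α) • g
  let v : Vec d := β • z.v + (1 - β) • WithLp.toLp 2 fun i => (g i) ^ 2
  let r := α * z.r + (1 - α)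
  let rbar := β * z.rbar + (1 - β)
  { x := WithLp.toLp 2 fun i => z.x i - γ * ((m i / r) / (ε + √(v i / rbar)))
    m := m
    v := v
    r := r
    rbar := rbar }

/-- The iterates of decreasing stepsize Adam from `(x₀, 0, 0, 0, 0)`, driven by the sample
sequence `s 1, s 2, …`. -/
noncomputable def iter (f : Vec d → Ξ → ℝ) (ε : ℝ) (γ α β : ℕ → ℝ) (x₀ : Vec d) (s : ℕ → Ξ) :
    ℕ → State d
  | 0 => { x := x₀, m := 0, v := 0, r := 0, rbar := 0 }
  | n + 1 => step f ε (γ (n + 1)) (α (n + 1)) (β (n + 1)) (iter f ε γ α β x₀ s n) (s (n + 1))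

/-- The triple `z_n = (x_n, m_n, v_n)`. -/
noncomputable def triple (f : Vec d → Ξ → ℝ) (ε : ℝ) (γ α β : ℕ → ℝ) (x₀ : Vec d) (s : ℕ → Ξ)
    (n : ℕ) : Vec d × Vec d × Vec d :=
  ((iter f ε γ α β x₀ s n).x, (iter f ε γ α β x₀ s n).m, (iter f ε γ α β x₀ s n).v)

end DecrAdam

/-!
The proof uses a strict Lyapunov function and avoids the limiting differential equation.

Write `h_n = ∇F(x_n)` and let `p_n = 1 / (ε + √v̂_n)` be the preconditioner. Two observations make
the descent argument work. First, since `v_{n+1} ≥ β_{n+1} v_n`, the preconditioner grows by at most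
a deterministic factor `1 + κ_n` with `κ_n / γ_n → b / 2`, whatever the stochastic gradient is
(`preconditioner_le`). Hence `F(x_n) + ⟨p_{n+1} m_{n+1}, m_{n+1}⟩ / (2 a)` decreases at the rate
`(1 - b / (4 a)) γ_n ⟨p_n m_n, m_n⟩`, up to noise and to an error `o(γ_n) ‖h_n‖ ‖m_n‖`, which comes
from the fact that `(1 - α_n) / γ_n → a` holds without any rate. Second, subtracting a small multiple
of `⟨h_n, m_{n+1}⟩` yields a dissipation in `‖h_n‖²` as well, and the two together absorb the
`o(γ_n)` error (`drift_coord_le`, `lyapunov_step_coord`). What remains is a centred noise and a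
term `O(γ_n² (1 + ‖∇f(x_n, ξ_{n+1})‖²))`.

The noise series are `L²`-bounded martingales, once the trajectory is truncated to a ball
(`ae_exists_tendsto_noise`, `IsIIDSample.ae_noiseConverges`). So along almost every trajectory
`∑ γ_n ‖h_n‖² < ∞` (`AdamPath.summable_gradient_sq`), and as `h_n` moves by `O(γ_n)`, it tends to `0`
(`tendsto_zero_of_summable_mul_sq`). The recursions for `m_n` and `v_n - S(x_n)` are averages with
vanishing inputs and convergent noise, so both tend to `0` (`tendsto_zero_of_contraction`). When the
critical points are countable, the trajectory, whose increments vanish, has only one cluster point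
(`exists_tendsto_of_countable_clusterPts`).

The regularity of `F` rests on the quadratic mean error of the first order Taylor expansion of
`f(·, ξ)`, obtained from the mean Lipschitz condition by integration along segments
(`Model.lintegral_taylor_le`).
-/

namespace DecrAdam

/-! ### Regularity of the objective -/

section Model

variable {d : ℕ} {Ξ : Type*} [MeasurableSpace Ξ] {f : Vec d → Ξ → ℝ} {μ : Measure Ξ}

theorem Model.hasGradientAt (hf : Model f μ) (x : Vec d) (s : Ξ) :
    HasGradientAt (fun y => f y s) (grad f x s) x :=
  (hf.differentiable s x).hasGradientAt

/-- The partial derivatives as limits of difference quotients, which makes them measurable. -/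
theorem Model.tendsto_grad_apply (hf : Model f μ) (x : Vec d) (s : Ξ) (i : Fin d) :
    Tendsto (fun n : ℕ => ((n : ℝ) + 1) *
      (f (x + ((n : ℝ) + 1)⁻¹ • EuclideanSpace.single i 1) s - f x s)) atTop
      (𝓝 (grad f x s i)) := by
  have h := (hf.hasGradientAt x s).hasFDerivAt
  have hc : Tendsto (fun n : ℕ => ‖(n : ℝ) + 1‖) atTop atTop :=
    tendsto_norm_atTop_atTop.comp (tendsto_natCast_atTop_atTop.atTop_add tendsto_const_nhds)
  simpa [EuclideanSpace.inner_single_right] using h.lim (EuclideanSpace.single i (1 : ℝ)) hc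

theorem Model.measurable_grad (hf : Model f μ) :
    Measurable fun q : Vec d × Ξ => grad f q.1 q.2 := by
  have : Measurable fun q : Vec d × Ξ => fun i => grad f q.1 q.2 i := by
    refine measurable_pi_lambda _ fun i => ?_
    refine measurable_of_tendsto_metrizable (f := fun (n : ℕ) (q : Vec d × Ξ) => ((n : ℝ) + 1) *
      (f (q.1 + ((n : ℝ) + 1)⁻¹ • EuclideanSpace.single i 1) q.2 - f q.1 q.2)) ?_ ?_
    · intro n
      refine measurable_const.mul (Measurable.sub ?_ hf.measurable)
      exact hf.measurable.comp ((measurable_fst.add_const _).prodMk measurable_snd)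
    · rw [tendsto_pi_nhds]
      exact fun q => hf.tendsto_grad_apply q.1 q.2 i
  exact (WithLp.measurable_toLp 2 _).comp this

theorem Model.measurable_grad_right (hf : Model f μ) (x : Vec d) : Measurable (grad f x) :=
  hf.measurable_grad.comp measurable_prodMk_left

/-- Taylor's formula along a segment, for a continuously differentiable function. -/
theorem enorm_taylor_le {φ : Vec d → ℝ} (hφ : ContDiff ℝ 1 φ) (x y : Vec d) :
    ‖φ x - φ y - inner ℝ (gradient φ y) (x - y)‖ₑ ≤
      ‖x - y‖ₑ * ∫⁻ t in Set.Ioc (0 : ℝ) 1, ‖gradient φ (y + t • (x - y)) - gradient φ y‖ₑ := by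
  have hd : Differentiable ℝ φ := hφ.differentiable (by norm_num)
  have hgc : Continuous (gradient φ) :=
    (InnerProductSpace.toDual ℝ (Vec d)).symm.continuous.comp (hφ.continuous_fderiv (by norm_num))
  have hder : ∀ t : ℝ, HasDerivAt (fun t : ℝ => φ (y + t • (x - y)))
      (inner ℝ (gradient φ (y + t • (x - y))) (x - y)) t := by
    intro t
    have h1 := (hd (y + t • (x - y))).hasGradientAt.hasFDerivAt
    have h2 : HasDerivAt (fun t : ℝ => y + t • (x - y)) ((1 : ℝ) • (x - y)) t :=
      ((hasDerivAt_id t).smul_const (x - y)).const_add y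
    have h3 := h1.comp_hasDerivAt t h2
    simpa [Function.comp_def] using h3
  have hc : Continuous fun t : ℝ => inner ℝ (gradient φ (y + t • (x - y))) (x - y) := by
    fun_prop
  have hftc := intervalIntegral.integral_eq_sub_of_hasDerivAt (a := 0) (b := 1)
    (fun t _ => hder t) (hc.intervalIntegrable _ _)
  have hrepr : φ x - φ y - inner ℝ (gradient φ y) (x - y) =
      ∫ t in (0 : ℝ)..1, inner ℝ (gradient φ (y + t • (x - y)) - gradient φ y) (x - y) := by
    simp only [inner_sub_left]
    rw [intervalIntegral.integral_sub (hc.intervalIntegrable _ _) (by simp), hftc]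
    simp
  rw [hrepr, intervalIntegral.integral_of_le zero_le_one]
  refine (enorm_integral_le_lintegral_enorm _).trans ?_
  rw [← lintegral_const_mul' _ _ (by simp)]
  refine lintegral_mono fun t => ?_
  rw [mul_comm]
  simp only [← ofReal_norm]
  rw [← ENNReal.ofReal_mul (norm_nonneg _)]
  exact ENNReal.ofReal_le_ofReal (norm_inner_le_norm _ _)

/-- A bound on a second moment bounds the first moment. -/
theorem lintegral_enorm_le_of_sq [IsProbabilityMeasure μ] {E : Type*} [NormedAddCommGroup E]
    {u : Ξ → E} (hu : AEStronglyMeasurable u μ) {C : ℝ} (hC : 0 ≤ C)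
    (h : ∫⁻ s, ‖u s‖ₑ ^ 2 ∂μ ≤ ENNReal.ofReal (C ^ 2)) :
    ∫⁻ s, ‖u s‖ₑ ∂μ ≤ ENNReal.ofReal C := by
  have h1 := eLpNorm_le_eLpNorm_of_exponent_le (p := 1) (q := 2) (by norm_num) hu
  rw [eLpNorm_one_eq_lintegral_enorm] at h1
  refine h1.trans ?_
  rw [eLpNorm_eq_lintegral_rpow_enorm_toReal (by norm_num) (by norm_num)]
  simp only [ENNReal.toReal_ofNat, ENNReal.rpow_ofNat, one_div]
  calc (∫⁻ s, ‖u s‖ₑ ^ 2 ∂μ) ^ (2⁻¹ : ℝ) ≤ (ENNReal.ofReal (C ^ 2)) ^ (2⁻¹ : ℝ) := by gcongr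
    _ = ENNReal.ofReal C := by
        rw [ENNReal.ofReal_rpow_of_nonneg (by positivity) (by norm_num), ← one_div,
          ← Real.sqrt_eq_rpow, Real.sqrt_sq hC]

/-- The mean error of the first order Taylor expansion of the cost is quadratic on balls. -/
theorem Model.lintegral_taylor_le [IsProbabilityMeasure μ] (hf : Model f μ) (R : ℝ) :
    ∃ L : ℝ, 0 < L ∧ (∀ x ∈ Metric.closedBall (0 : Vec d) R, ∀ y ∈ Metric.closedBall (0 : Vec d) R,
      ∫⁻ s, ‖grad f x s - grad f y s‖ₑ ^ 2 ∂μ ≤ ENNReal.ofReal ((L * ‖x - y‖) ^ 2) ∧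
      ∫⁻ s, ‖grad f x s - grad f y s‖ₑ ∂μ ≤ ENNReal.ofReal (L * ‖x - y‖) ∧
      ∫⁻ s, ‖f x s - f y s - inner ℝ (grad f y s) (x - y)‖ₑ ∂μ ≤
        ENNReal.ofReal (L * ‖x - y‖ ^ 2)) := by
  obtain ⟨L, hL, h⟩ := hf.lipschitz (Metric.closedBall 0 R) (isCompact_closedBall 0 R)
  have hfirst : ∀ x ∈ Metric.closedBall (0 : Vec d) R, ∀ y ∈ Metric.closedBall (0 : Vec d) R,
      ∫⁻ s, ‖grad f x s - grad f y s‖ₑ ∂μ ≤ ENNReal.ofReal (L * ‖x - y‖) := by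
    intro x hx y hy
    refine lintegral_enorm_le_of_sq ?_ (by positivity) ((h x hx y hy).trans_eq (by ring_nf))
    exact ((hf.measurable_grad_right x).sub (hf.measurable_grad_right y)).aestronglyMeasurable
  refine ⟨L, hL, fun x hx y hy => ⟨(h x hx y hy).trans_eq (by ring_nf), hfirst x hx y hy, ?_⟩⟩
  have hm : Measurable fun q : Ξ × ℝ => ‖grad f (y + q.2 • (x - y)) q.1 - grad f y q.1‖ₑ := by
    refine Measurable.enorm (Measurable.sub ?_ ?_)
    · refine hf.measurable_grad.comp (Measurable.prodMk ?_ measurable_fst)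
      fun_prop
    · exact (hf.measurable_grad_right y).comp measurable_fst
  calc ∫⁻ s, ‖f x s - f y s - inner ℝ (grad f y s) (x - y)‖ₑ ∂μ
      ≤ ∫⁻ s, (‖x - y‖ₑ * ∫⁻ t in Set.Ioc (0 : ℝ) 1,
          ‖grad f (y + t • (x - y)) s - grad f y s‖ₑ) ∂μ := by
        refine lintegral_mono_ae ?_
        filter_upwards [hf.contDiff] with s hs
        exact enorm_taylor_le hs x y
    _ = ‖x - y‖ₑ * ∫⁻ t in Set.Ioc (0 : ℝ) 1,
          ∫⁻ s, ‖grad f (y + t • (x - y)) s - grad f y s‖ₑ ∂μ := by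
        rw [lintegral_const_mul' _ _ (by simp), lintegral_lintegral_swap hm.aemeasurable]
    _ ≤ ‖x - y‖ₑ * ∫⁻ t in Set.Ioc (0 : ℝ) 1, ENNReal.ofReal (L * ‖x - y‖) := by
        gcongr ‖x - y‖ₑ * ?_
        refine setLIntegral_mono' measurableSet_Ioc fun t ht => ?_
        have hz : y + t • (x - y) ∈ Metric.closedBall (0 : Vec d) R :=
          (convex_closedBall 0 R).add_smul_sub_mem hy hx ⟨ht.1.le, ht.2⟩
        refine (hfirst _ hz y hy).trans (ENNReal.ofReal_le_ofReal ?_)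
        rw [add_sub_cancel_left, norm_smul, Real.norm_of_nonneg ht.1.le]
        gcongr
        exact mul_le_of_le_one_left (norm_nonneg _) ht.2
    _ = ENNReal.ofReal (L * ‖x - y‖ ^ 2) := by
        rw [setLIntegral_const, Real.volume_Ioc, ← ofReal_norm, sub_zero, ENNReal.ofReal_one,
          mul_one, ← ENNReal.ofReal_mul (norm_nonneg _)]
        ring_nf

/-- The fourth moment of the stochastic gradient is bounded on balls. -/
theorem LocMoment.exists_bound (hmom : LocMoment f μ 4) (R : ℝ) :
    ∃ C : ℝ≥0∞, C < ∞ ∧ ∀ x ∈ Metric.closedBall (0 : Vec d) R,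
      ∫⁻ s, ‖grad f x s‖ₑ ^ 4 ∂μ ≤ C := by
  refine ⟨_, hmom (Metric.closedBall 0 R) (isCompact_closedBall 0 R), fun x hx => ?_⟩
  refine le_trans (le_of_eq ?_) (le_iSup₂ (f := fun x (_ : x ∈ Metric.closedBall (0 : Vec d) R) =>
    ∫⁻ s, ‖grad f x s‖ₑ ^ (4 : ℝ) ∂μ) x hx)
  simp

/-- The second moment of the stochastic gradient is bounded on balls. -/
theorem LocMoment.exists_bound_sq [IsProbabilityMeasure μ] (hmom : LocMoment f μ 4) (R : ℝ) :
    ∃ C : ℝ≥0∞, C < ∞ ∧ ∀ x ∈ Metric.closedBall (0 : Vec d) R,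
      ∫⁻ s, ‖grad f x s‖ₑ ^ 2 ∂μ ≤ C := by
  obtain ⟨C, hC, h⟩ := hmom.exists_bound R
  refine ⟨1 + C, ENNReal.add_lt_top.2 ⟨ENNReal.one_lt_top, hC⟩, fun x hx => ?_⟩
  calc ∫⁻ s, ‖grad f x s‖ₑ ^ 2 ∂μ ≤ ∫⁻ s, (1 + ‖grad f x s‖ₑ ^ 4) ∂μ := by
        refine lintegral_mono fun s => ?_
        rcases le_total (‖grad f x s‖ₑ) 1 with h1 | h1
        · exact (pow_le_one₀ zero_le h1).trans le_self_add
        · exact (pow_le_pow_right₀ h1 (by norm_num)).trans le_add_self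
    _ = 1 + ∫⁻ s, ‖grad f x s‖ₑ ^ 4 ∂μ := by
        rw [lintegral_add_left measurable_const]; simp
    _ ≤ 1 + C := by gcongr; exact h x hx

theorem Model.memLp_grad [IsProbabilityMeasure μ] (hf : Model f μ) (hmom : LocMoment f μ 4)
    (x : Vec d) : MemLp (grad f x) 2 μ := by
  obtain ⟨C, hC, h⟩ := hmom.exists_bound_sq ‖x‖
  refine ⟨(hf.measurable_grad_right x).aestronglyMeasurable, ?_⟩
  rw [eLpNorm_lt_top_iff_lintegral_rpow_enorm_lt_top (by norm_num) (by norm_num)]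
  simpa using (h x (by simp)).trans_lt hC

theorem Model.integrable_grad [IsProbabilityMeasure μ] (hf : Model f μ) (hmom : LocMoment f μ 4)
    (x : Vec d) : Integrable (grad f x) μ :=
  (hf.memLp_grad hmom x).integrable (by norm_num)

theorem Model.integrable_cost [IsProbabilityMeasure μ] (hf : Model f μ) (hmom : LocMoment f μ 4)
    (x : Vec d) : Integrable (f x) μ := by
  obtain ⟨y, hy, -⟩ := hf.exists_point
  obtain ⟨L, -, h⟩ := hf.lintegral_taylor_le (max ‖x‖ ‖y‖)
  have h2 := (h x (by simp) y (by simp)).2.2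
  have hmeas : ∀ z, Measurable (f z) := fun z => hf.measurable.comp measurable_prodMk_left
  have hin : Integrable (fun s => inner ℝ (grad f y s) (x - y)) μ :=
    (hf.integrable_grad hmom y).inner_const _
  have h3 : Integrable (fun s => f x s - f y s - inner ℝ (grad f y s) (x - y)) μ :=
    ⟨(((hmeas x).sub (hmeas y)).aestronglyMeasurable).sub hin.1,
      h2.trans_lt ENNReal.ofReal_lt_top⟩
  refine ((h3.add hin).add hy).congr (Eventually.of_forall fun s => ?_)
  simp

/-- The mean of the stochastic gradient provides first order Taylor expansions of the objective
and is Lipschitz on balls. -/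
theorem Model.norm_taylor_le [IsProbabilityMeasure μ] (hf : Model f μ) (hmom : LocMoment f μ 4)
    (R : ℝ) : ∃ L : ℝ, 0 < L ∧
      ∀ x ∈ Metric.closedBall (0 : Vec d) R, ∀ y ∈ Metric.closedBall (0 : Vec d) R,
      ‖F f μ x - F f μ y - inner ℝ (∫ s, grad f y s ∂μ) (x - y)‖ ≤ L * ‖x - y‖ ^ 2 ∧
      ‖∫ s, grad f x s ∂μ - ∫ s, grad f y s ∂μ‖ ≤ L * ‖x - y‖ := by
  obtain ⟨L, hL, h⟩ := hf.lintegral_taylor_le R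
  refine ⟨L, hL, fun x hx y hy => ?_⟩
  obtain ⟨-, h1, h2⟩ := h x hx y hy
  have hi := hf.integrable_grad hmom
  have hc := hf.integrable_cost hmom
  constructor
  · have : F f μ x - F f μ y - inner ℝ (∫ s, grad f y s ∂μ) (x - y) =
        ∫ s, (f x s - f y s - inner ℝ (grad f y s) (x - y)) ∂μ := by
      rw [integral_sub (f := fun s => f x s - f y s) ((hc x).sub (hc y)) ((hi y).inner_const _),
        integral_sub (hc x) (hc y)]
      simp_rw [fun s => real_inner_comm (x - y) (grad f y s)]
      rw [integral_inner (hi y), real_inner_comm]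
      rfl
    rw [this]
    refine (ENNReal.ofReal_le_ofReal_iff (by positivity)).1 ?_
    rw [ofReal_norm]
    exact (enorm_integral_le_lintegral_enorm _).trans h2
  · rw [← integral_sub (hi x) (hi y)]
    refine (ENNReal.ofReal_le_ofReal_iff (by positivity)).1 ?_
    rw [ofReal_norm]
    exact (enorm_integral_le_lintegral_enorm _).trans h1

/-- The gradient of the objective is the mean of the stochastic gradient. -/
theorem Model.hasGradientAt_F [IsProbabilityMeasure μ] (hf : Model f μ) (hmom : LocMoment f μ 4)
    (x : Vec d) : HasGradientAt (F f μ) (∫ s, grad f x s ∂μ) x := by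
  obtain ⟨L, hL, h⟩ := hf.norm_taylor_le hmom (‖x‖ + 1)
  rw [hasGradientAt_iff_isLittleO]
  have hO : (fun y => F f μ y - F f μ x - inner ℝ (∫ s, grad f x s ∂μ) (y - x)) =O[𝓝 x]
      fun y => ‖y - x‖ ^ 2 := by
    refine Asymptotics.IsBigO.of_bound L ?_
    filter_upwards [Metric.ball_mem_nhds x one_pos] with y hy
    rw [norm_pow, norm_norm]
    refine (h y ?_ x (by simp)).1
    have : ‖y - x‖ < 1 := by simpa [dist_eq_norm] using hy
    have := norm_le_norm_add_norm_sub' y x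
    simp only [mem_closedBall_zero_iff]
    linarith
  refine hO.trans_isLittleO ?_
  have : (fun y => ‖y - x‖ ^ 2) =o[𝓝 x] fun y => ‖y - x‖ := by
    simp_rw [pow_two]
    have h0 : Tendsto (fun y => ‖y - x‖) (𝓝 x) (𝓝 0) := by
      have : Continuous fun y => ‖y - x‖ := by fun_prop
      simpa using this.tendsto x
    simpa using (Asymptotics.isLittleO_one_iff ℝ).2 h0 |>.mul_isBigO
      (Asymptotics.isBigO_refl (fun y => ‖y - x‖) (𝓝 x))
  exact this.norm_right.congr_right (by simp) |>.of_norm_right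

theorem Model.gradient_F [IsProbabilityMeasure μ] (hf : Model f μ) (hmom : LocMoment f μ 4)
    (x : Vec d) : gradient (F f μ) x = ∫ s, grad f x s ∂μ :=
  (hf.hasGradientAt_F hmom x).gradient

/-- The descent estimate, and local Lipschitz continuity of `∇F`. -/
theorem Model.exists_lipschitz_gradient_F [IsProbabilityMeasure μ] (hf : Model f μ)
    (hmom : LocMoment f μ 4) (R : ℝ) : ∃ L : ℝ, 0 < L ∧
      ∀ x ∈ Metric.closedBall (0 : Vec d) R, ∀ y ∈ Metric.closedBall (0 : Vec d) R,
      |F f μ x - F f μ y - inner ℝ (gradient (F f μ) y) (x - y)| ≤ L * ‖x - y‖ ^ 2 ∧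
      ‖gradient (F f μ) x - gradient (F f μ) y‖ ≤ L * ‖x - y‖ := by
  simpa only [hf.gradient_F hmom, Real.norm_eq_abs] using hf.norm_taylor_le hmom R

theorem Model.integrable_sq [IsProbabilityMeasure μ] (hf : Model f μ) (hmom : LocMoment f μ 4)
    (x : Vec d) (i : Fin d) : Integrable (fun s => (grad f x s i) ^ 2) μ := by
  have h := hf.memLp_grad hmom x
  have : MemLp (fun s => grad f x s i) 2 μ := by
    refine h.of_le ?_ (Eventually.of_forall fun s => PiLp.norm_apply_le _ i)
    have := hf.measurable_grad_right x
    fun_prop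
  exact this.integrable_sq

/-- The second moment map `S` is Lipschitz on balls: `|u² - w²| ≤ |u - w| |u + w|`, and Young's
inequality with parameter `‖x - y‖` replaces that of Cauchy and Schwarz. -/
theorem Model.exists_lipschitz_S [IsProbabilityMeasure μ] (hf : Model f μ)
    (hmom : LocMoment f μ 4) (R : ℝ) : ∃ L : ℝ, 0 < L ∧
      ∀ x ∈ Metric.closedBall (0 : Vec d) R, ∀ y ∈ Metric.closedBall (0 : Vec d) R, ∀ i,
      |S f μ x i - S f μ y i| ≤ L * ‖x - y‖ := by
  obtain ⟨L, hL, h⟩ := hf.lintegral_taylor_le R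
  obtain ⟨C, hC, hb⟩ := hmom.exists_bound_sq R
  refine ⟨L ^ 2 + 4 * C.toReal, by positivity, fun x hx y hy i => ?_⟩
  rcases eq_or_ne x y with rfl | hne
  · simp
  have hδ : 0 < ‖x - y‖ := norm_pos_iff.2 (sub_ne_zero.2 hne)
  set δ := ‖x - y‖
  have hsq : ∀ z, Integrable (fun s => ‖grad f z s‖ ^ 2) μ := fun z =>
    (hf.memLp_grad hmom z).integrable_norm_pow (by norm_num)
  have hdiff : Integrable (fun s => ‖grad f x s - grad f y s‖ ^ 2) μ :=
    ((hf.memLp_grad hmom x).sub (hf.memLp_grad hmom y)).integrable_norm_pow (by norm_num)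
  have hto : ∀ u : Ξ → Vec d, Measurable u → ∀ B : ℝ, 0 ≤ B →
      ∫⁻ s, ‖u s‖ₑ ^ 2 ∂μ ≤ ENNReal.ofReal B → ∫ s, ‖u s‖ ^ 2 ∂μ ≤ B := by
    intro u hu B hB h
    rw [integral_eq_lintegral_of_nonneg_ae (Eventually.of_forall fun s => by positivity)
      (by fun_prop)]
    refine ENNReal.toReal_le_of_le_ofReal hB (le_trans (le_of_eq ?_) h)
    refine lintegral_congr fun s => ?_
    rw [ENNReal.ofReal_pow (norm_nonneg _), ofReal_norm]
  have h1 := hto _ ((hf.measurable_grad_right x).sub (hf.measurable_grad_right y)) _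
    (by positivity) (h x hx y hy).1
  have h2 := fun z hz => hto _ (hf.measurable_grad_right z) _ ENNReal.toReal_nonneg
    ((hb z hz).trans_eq (ENNReal.ofReal_toReal hC.ne).symm)
  have hS : S f μ x i - S f μ y i = ∫ s, ((grad f x s i) ^ 2 - (grad f y s i) ^ 2) ∂μ := by
    rw [integral_sub (hf.integrable_sq hmom x i) (hf.integrable_sq hmom y i)]; rfl
  rw [hS]
  have hsum : Integrable (fun s => 2 * ‖grad f x s‖ ^ 2 + 2 * ‖grad f y s‖ ^ 2) μ :=
    ((hsq x).const_mul 2).add ((hsq y).const_mul 2)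
  have hpt : ∀ s, |(grad f x s i) ^ 2 - (grad f y s i) ^ 2| ≤
      δ⁻¹ * ‖grad f x s - grad f y s‖ ^ 2 +
        δ * (2 * ‖grad f x s‖ ^ 2 + 2 * ‖grad f y s‖ ^ 2) := by
    intro s
    have e1 : |grad f x s i - grad f y s i| ≤ ‖grad f x s - grad f y s‖ := by
      simpa using PiLp.norm_apply_le (grad f x s - grad f y s) i
    have e2 : |grad f x s i| ≤ ‖grad f x s‖ := by simpa using PiLp.norm_apply_le (grad f x s) i
    have e3 : |grad f y s i| ≤ ‖grad f y s‖ := by simpa using PiLp.norm_apply_le (grad f y s) i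
    have e4 : |grad f x s i + grad f y s i| ≤ ‖grad f x s‖ + ‖grad f y s‖ :=
      (abs_add_le _ _).trans (add_le_add e2 e3)
    rw [sq_sub_sq, abs_mul, mul_comm]
    set A := ‖grad f x s - grad f y s‖
    set B := ‖grad f x s‖ + ‖grad f y s‖ with hB
    have hAB : |grad f x s i - grad f y s i| * |grad f x s i + grad f y s i| ≤ A * B := by
      gcongr
    have hyoung : A * B ≤ δ⁻¹ * A ^ 2 + δ * B ^ 2 := by
      have h5 : δ⁻¹ * A ^ 2 = δ * (δ⁻¹ * A) ^ 2 := by field_simp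
      have h6 : A * B = δ * ((δ⁻¹ * A) * B) := by field_simp
      rw [h5, h6, ← mul_add]
      gcongr
      nlinarith [sq_nonneg (δ⁻¹ * A - B), sq_nonneg (δ⁻¹ * A), sq_nonneg B]
    have hB2 : B ^ 2 ≤ 2 * ‖grad f x s‖ ^ 2 + 2 * ‖grad f y s‖ ^ 2 := by
      rw [hB]; nlinarith [sq_nonneg (‖grad f x s‖ - ‖grad f y s‖)]
    calc _ ≤ A * B := hAB
      _ ≤ _ := hyoung
      _ ≤ _ := by gcongr
  calc |∫ s, ((grad f x s i) ^ 2 - (grad f y s i) ^ 2) ∂μ|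
      ≤ ∫ s, |(grad f x s i) ^ 2 - (grad f y s i) ^ 2| ∂μ := abs_integral_le_integral_abs
    _ ≤ ∫ s, (δ⁻¹ * ‖grad f x s - grad f y s‖ ^ 2 +
        δ * (2 * ‖grad f x s‖ ^ 2 + 2 * ‖grad f y s‖ ^ 2)) ∂μ := by
        refine integral_mono ((hf.integrable_sq hmom x i).sub (hf.integrable_sq hmom y i)).abs ?_
          hpt
        exact (hdiff.const_mul _).add (hsum.const_mul _)
    _ = δ⁻¹ * ∫ s, ‖grad f x s - grad f y s‖ ^ 2 ∂μ +
        δ * (2 * ∫ s, ‖grad f x s‖ ^ 2 ∂μ + 2 * ∫ s, ‖grad f y s‖ ^ 2 ∂μ) := by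
        rw [integral_add (hdiff.const_mul _) (hsum.const_mul _), integral_const_mul,
          integral_const_mul, integral_add ((hsq x).const_mul 2) ((hsq y).const_mul 2),
          integral_const_mul, integral_const_mul]
    _ ≤ δ⁻¹ * (L * δ) ^ 2 + δ * (2 * C.toReal + 2 * C.toReal) := by
        gcongr
        · exact h1
        · exact h2 x hx
        · exact h2 y hy
    _ = (L ^ 2 + 4 * C.toReal) * δ := by field_simp; ring

/-- A map that is Lipschitz on every centred ball is continuous. -/
theorem continuous_of_lipschitz_on_balls {E : Type*} [NormedAddCommGroup E] {φ : Vec d → E}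
    (h : ∀ R : ℝ, ∃ L : ℝ, 0 < L ∧ ∀ x ∈ Metric.closedBall (0 : Vec d) R,
      ∀ y ∈ Metric.closedBall (0 : Vec d) R, ‖φ x - φ y‖ ≤ L * ‖x - y‖) : Continuous φ := by
  refine continuous_iff_continuousAt.2 fun x => ?_
  obtain ⟨L, hL, hb⟩ := h (‖x‖ + 1)
  refine tendsto_iff_norm_sub_tendsto_zero.2 ?_
  refine squeeze_zero' (g := fun y => L * ‖y - x‖) (Eventually.of_forall fun _ => norm_nonneg _)
    ?_ ?_
  · filter_upwards [Metric.ball_mem_nhds x one_pos] with y hy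
    refine hb y ?_ x (by simp)
    have : ‖y - x‖ < 1 := by simpa [dist_eq_norm] using hy
    have := norm_le_norm_add_norm_sub' y x
    simp only [mem_closedBall_zero_iff]
    linarith
  · have : Continuous fun y => L * ‖y - x‖ := by fun_prop
    simpa using this.tendsto x

theorem Model.continuous_gradient_F [IsProbabilityMeasure μ] (hf : Model f μ)
    (hmom : LocMoment f μ 4) : Continuous (gradient (F f μ)) := by
  refine continuous_of_lipschitz_on_balls fun R => ?_
  obtain ⟨L, hL, h⟩ := hf.exists_lipschitz_gradient_F hmom R
  exact ⟨L, hL, fun x hx y hy => (h x hx y hy).2⟩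

theorem Model.continuous_F [IsProbabilityMeasure μ] (hf : Model f μ) (hmom : LocMoment f μ 4) :
    Continuous (F f μ) :=
  continuous_iff_continuousAt.2 fun x => (hf.hasGradientAt_F hmom x).continuousAt

theorem Model.continuous_S [IsProbabilityMeasure μ] (hf : Model f μ) (hmom : LocMoment f μ 4) :
    Continuous (S f μ) := by
  have : Continuous fun x => fun i => S f μ x i := by
    refine continuous_pi fun i => continuous_of_lipschitz_on_balls fun R => ?_
    obtain ⟨L, hL, h⟩ := hf.exists_lipschitz_S hmom R
    exact ⟨L, hL, fun x hx y hy => h x hx y hy i⟩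
  exact (PiLp.continuous_toLp 2 _).comp this

/-- A coercive objective attains its minimum, so it has a critical point. -/
theorem Model.crit_nonempty [IsProbabilityMeasure μ] (hf : Model f μ) (hmom : LocMoment f μ 4)
    (hco : Tendsto (F f μ) (Bornology.cobounded (Vec d)) atTop) : (crit f μ).Nonempty := by
  rw [Metric.cobounded_eq_cocompact] at hco
  obtain ⟨x, hx⟩ := (hf.continuous_F hmom).exists_forall_le hco
  refine ⟨x, ?_⟩
  have h0 : fderiv ℝ (F f μ) x = 0 :=
    IsLocalMin.fderiv_eq_zero (Eventually.of_forall hx)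
  simp [crit, gradient, h0]

end Model

/-! ### Convergence of real sequences -/

section Sequences

/-- Averaging with weights of divergent sum forgets the initial value, a vanishing input and
a convergent series of perturbations. -/
theorem tendsto_zero_of_contraction {u a e w : ℕ → ℝ} (ha0 : ∀ n, 0 ≤ a n) (ha1 : ∀ n, a n ≤ 1)
    (hsum : Tendsto (fun N => ∑ n ∈ Finset.range N, a n) atTop atTop)
    (he : Tendsto e atTop (𝓝 0))
    (hw : ∃ l, Tendsto (fun N => ∑ n ∈ Finset.range N, w n) atTop (𝓝 l))
    (hrec : ∀ᶠ n in atTop, u (n + 1) = (1 - a n) * u n + a n * e n + w n) :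
    Tendsto u atTop (𝓝 0) := by
  obtain ⟨l, hl⟩ := hw
  obtain ⟨N₁, hrec⟩ := eventually_atTop.1 hrec
  -- Adding the tail of the series of perturbations to `u` moves them into the input.
  set T : ℕ → ℝ := fun n => l - ∑ k ∈ Finset.range n, w k with hT
  have hT0 : Tendsto T atTop (𝓝 0) := by simpa using hl.const_sub l
  have hy : ∀ n ≥ N₁, u (n + 1) + T (n + 1) = (1 - a n) * (u n + T n) + a n * (e n + T n) := by
    intro n hn
    simp only [hT, Finset.sum_range_succ, hrec n hn]
    ring
  have hδ : Tendsto (fun n => e n + T n) atTop (𝓝 0) := by simpa using he.add hT0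
  suffices h : Tendsto (fun n => u n + T n) atTop (𝓝 0) by
    simpa using h.sub hT0
  rw [Metric.tendsto_atTop] at hδ ⊢
  intro ε hε
  obtain ⟨N₂, hN⟩ := hδ (ε / 2) (half_pos hε)
  obtain ⟨N, hN₁, hN₂⟩ : ∃ N, N₁ ≤ N ∧ N₂ ≤ N := ⟨max N₁ N₂, le_max_left _ _, le_max_right _ _⟩
  have hbound : ∀ k, |u (N + k) + T (N + k)| ≤
      ε / 2 + |u N + T N| * Real.exp (-∑ j ∈ Finset.range k, a (N + j)) := by
    intro k
    induction k with
    | zero => simp; linarith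
    | succ k ih =>
      rw [← add_assoc, hy (N + k) (by omega), Finset.sum_range_succ, neg_add, Real.exp_add]
      have h1 : |e (N + k) + T (N + k)| ≤ ε / 2 := by
        have := hN (N + k) (by omega)
        rw [dist_zero_right, Real.norm_eq_abs] at this
        exact this.le
      have h2 := Real.one_sub_le_exp_neg (a (N + k))
      have h3 : 0 ≤ 1 - a (N + k) := sub_nonneg.2 (ha1 _)
      set E := Real.exp (-∑ j ∈ Finset.range k, a (N + j))
      have hE : 0 ≤ |u N + T N| * E := by positivity
      calc _ ≤ |(1 - a (N + k)) * (u (N + k) + T (N + k))| +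
              |a (N + k) * (e (N + k) + T (N + k))| :=
            abs_add_le _ _
        _ = (1 - a (N + k)) * |u (N + k) + T (N + k)| + a (N + k) * |e (N + k) + T (N + k)| := by
            rw [abs_mul, abs_mul, abs_of_nonneg h3, abs_of_nonneg (ha0 _)]
        _ ≤ (1 - a (N + k)) * (ε / 2 + |u N + T N| * E) + a (N + k) * (ε / 2) := by
            gcongr
            exact ha0 _
        _ = ε / 2 + (|u N + T N| * E) * (1 - a (N + k)) := by ring
        _ ≤ ε / 2 + (|u N + T N| * E) * Real.exp (-a (N + k)) := by gcongr
        _ = _ := by ring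
  have htail : Tendsto (fun k => ∑ j ∈ Finset.range k, a (N + j)) atTop atTop := by
    have h1 : Tendsto (fun k => ∑ n ∈ Finset.range (N + k), a n) atTop atTop :=
      hsum.comp (tendsto_atTop_mono (fun k => Nat.le_add_left k N) tendsto_id)
    simp_rw [Finset.sum_range_add] at h1
    refine (tendsto_atTop_add_const_left _ (-∑ n ∈ Finset.range N, a n) h1).congr fun k => ?_
    ring
  have hexp : Tendsto (fun k => |u N + T N| * Real.exp (-∑ j ∈ Finset.range k, a (N + j))) atTop
      (𝓝 0) := by
    simpa using (Real.tendsto_exp_neg_atTop_nhds_zero.comp htail).const_mul |u N + T N|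
  obtain ⟨K, hK⟩ := eventually_atTop.1 (hexp.eventually_lt_const (half_pos hε))
  refine ⟨N + K, fun n hn => ?_⟩
  obtain ⟨k, rfl⟩ : ∃ k, n = N + k := ⟨n - N, by omega⟩
  rw [dist_zero_right, Real.norm_eq_abs]
  have := hbound k
  have := hK k (by omega)
  linarith

/-- If `∑ γ h²` converges while `∑ γ` diverges, and `h` moves by `O(γ)`, then `h` vanishes: the
increments of `h³` are `O(γ h²)`, so that `h³` converges. -/
theorem tendsto_zero_of_summable_mul_sq {γ h : ℕ → ℝ} (hγ : ∀ n, 0 < γ n)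
    (hsum : Tendsto (fun N => ∑ n ∈ Finset.range N, γ n) atTop atTop) (h0 : ∀ n, 0 ≤ h n)
    (hs : Summable fun n => γ n * h n ^ 2) (hs' : Summable fun n => γ n * h (n + 1) ^ 2)
    {C : ℝ} (hlip : ∀ᶠ n in atTop, |h (n + 1) - h n| ≤ C * γ n) : Tendsto h atTop (𝓝 0) := by
  have hdist : Summable fun n => dist (h n ^ 3) (h n.succ ^ 3) := by
    refine Summable.of_norm_bounded_eventually_nat
      (g := fun n => 2 * C * (γ n * h n ^ 2 + γ n * h (n + 1) ^ 2)) ((hs.add hs').mul_left _) ?_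
    filter_upwards [hlip] with n hn
    rw [Real.norm_of_nonneg dist_nonneg, Real.dist_eq, Nat.succ_eq_add_one]
    have h1 : h n ^ 3 - h (n + 1) ^ 3 =
        -((h (n + 1) - h n) * (h (n + 1) ^ 2 + h (n + 1) * h n + h n ^ 2)) := by ring
    have := h0 n
    have := h0 (n + 1)
    rw [h1, abs_neg, abs_mul, abs_of_nonneg (a := h (n + 1) ^ 2 + h (n + 1) * h n + h n ^ 2)
      (by positivity)]
    calc _ ≤ (C * γ n) * (h (n + 1) ^ 2 + h (n + 1) * h n + h n ^ 2) := by gcongr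
      _ ≤ (C * γ n) * (2 * (h n ^ 2 + h (n + 1) ^ 2)) := by
          have : 0 ≤ C * γ n := (abs_nonneg _).trans hn
          gcongr
          nlinarith [sq_nonneg (h n - h (n + 1))]
      _ = _ := by ring
  obtain ⟨c, hc⟩ := cauchySeq_tendsto_of_complete (cauchySeq_of_summable_dist hdist)
  have hlim : Tendsto h atTop (𝓝 (c ^ ((3 : ℕ) : ℝ)⁻¹)) := by
    refine (hc.rpow_const (Or.inr (by positivity))).congr fun n => ?_
    exact Real.pow_rpow_inv_natCast (h0 n) (by norm_num)
  set l := c ^ ((3 : ℕ) : ℝ)⁻¹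
  have hl0 : 0 ≤ l := ge_of_tendsto' hlim h0
  rcases hl0.eq_or_lt with hl | hl
  · rwa [← hl] at hlim
  · exfalso
    have hγs : Summable γ := by
      refine Summable.of_norm_bounded_eventually_nat (g := fun n => (l / 2)⁻¹ ^ 2 * (γ n * h n ^ 2))
        (hs.mul_left _) ?_
      filter_upwards [hlim.eventually_const_lt (half_lt_self hl)] with n hn
      rw [Real.norm_of_nonneg (hγ n).le]
      have h1 : 1 ≤ ((l / 2)⁻¹ * h n) ^ 2 := by
        have : 1 ≤ (l / 2)⁻¹ * h n := by
          rw [inv_mul_eq_div, one_le_div (by positivity)]; exact hn.le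
        nlinarith
      have := hγ n
      calc γ n = γ n * 1 := (mul_one _).symm
        _ ≤ γ n * ((l / 2)⁻¹ * h n) ^ 2 := by gcongr
        _ = _ := by ring
    exact not_tendsto_atTop_of_tendsto_nhds hγs.hasSum.tendsto_sum_nat hsum

/-- The total decrease of a bounded quantity is finite, up to a convergent perturbation. -/
theorem summable_of_eventually_le_sub {U t w : ℕ → ℝ} (ht : ∀ n, 0 ≤ t n) {B : ℝ}
    (hU : ∀ n, |U n| ≤ B) (hw : ∃ l, Tendsto (fun N => ∑ n ∈ Finset.range N, w n) atTop (𝓝 l))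
    (h : ∀ᶠ n in atTop, U (n + 1) ≤ U n - t n + w n) : Summable t := by
  obtain ⟨N, hN⟩ := eventually_atTop.1 h
  obtain ⟨l, hl⟩ := hw
  obtain ⟨M, hM⟩ := (Metric.isBounded_range_of_tendsto _ hl).exists_norm_le
  have hM' : ∀ n, |∑ k ∈ Finset.range n, w k| ≤ M := fun n => hM _ ⟨n, rfl⟩
  rw [← summable_nat_add_iff N]
  refine summable_of_sum_range_le (c := 2 * B + 2 * M) (fun n => ht _) fun K => ?_
  have hind : ∀ K, ∑ k ∈ Finset.range K, t (k + N) ≤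
      U N - U (N + K) + ∑ k ∈ Finset.range K, w (N + k) := by
    intro K
    induction K with
    | zero => simp
    | succ K ih =>
      rw [Finset.sum_range_succ, Finset.sum_range_succ, add_comm K N]
      have := hN (N + K) (by omega)
      rw [add_assoc] at this
      linarith
  have h1 := Finset.sum_range_add w N K
  have h2 := abs_le.1 (hM' N)
  have h3 := abs_le.1 (hM' (N + K))
  have h4 := abs_le.1 (hU N)
  have h5 := abs_le.1 (hU (N + K))
  have := hind K
  linarith

/-- If a continuous map vanishes along a sequence of a compact set, the sequence approaches the
zero set of the map. -/
theorem tendsto_infDist_zeros {X E : Type*} [PseudoMetricSpace X] [NormedAddCommGroup E]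
    {φ : X → E} (hφ : Continuous φ) {K : Set X} (hK : IsCompact K) {x : ℕ → X}
    (hx : ∀ n, x n ∈ K) (h : Tendsto (fun n => φ (x n)) atTop (𝓝 0)) :
    Tendsto (fun n => Metric.infDist (x n) (φ ⁻¹' {0})) atTop (𝓝 0) := by
  refine tendsto_of_subseq_tendsto fun ns hns => ?_
  obtain ⟨y, -, σ, hσ, hy⟩ := hK.tendsto_subseq fun k => hx (ns k)
  refine ⟨σ, ?_⟩
  have hy0 : φ y = 0 := tendsto_nhds_unique ((hφ.tendsto y).comp hy)
    (h.comp (hns.comp hσ.tendsto_atTop))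
  have hc := ((Metric.continuous_infDist_pt (φ ⁻¹' {0})).tendsto y).comp hy
  rwa [Metric.infDist_zero_of_mem (by simpa using hy0)] at hc

/-- A sequence of a compact set with vanishing increments whose cluster points form a countable
set converges: the distance to a cluster point takes a full interval of limit values as soon as
there are two cluster points. -/
theorem exists_tendsto_of_countable_clusterPts {X : Type*} [MetricSpace X]
    {K : Set X} (hK : IsCompact K) {x : ℕ → X} (hx : ∀ n, x n ∈ K)
    (hinc : Tendsto (fun n => dist (x (n + 1)) (x n)) atTop (𝓝 0)) {Z : Set X} (hZ : Z.Countable)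
    (hcl : ∀ y (σ : ℕ → ℕ), Tendsto σ atTop atTop → Tendsto (x ∘ σ) atTop (𝓝 y) → y ∈ Z) :
    ∃ y ∈ Z, Tendsto x atTop (𝓝 y) := by
  obtain ⟨p, -, σ, hσ, hp⟩ := hK.tendsto_subseq hx
  have hpZ := hcl p σ hσ.tendsto_atTop hp
  refine ⟨p, hpZ, ?_⟩
  by_contra hnot
  rw [Metric.tendsto_atTop] at hnot
  push Not at hnot
  obtain ⟨D, hD, hfar⟩ := hnot
  -- Every level `t` between `0` and `D` is crossed infinitely often, by ever smaller steps.
  have hlevel : Set.Ioo 0 D ⊆ (fun y => dist y p) '' Z := by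
    rintro t ⟨ht0, htD⟩
    have hcross : ∀ N : ℕ, ∃ n ≥ N, dist (x n) p ≤ t ∧ t < dist (x (n + 1)) p := by
      intro N
      have hnear : ∃ n ≥ N, dist (x n) p ≤ t := by
        obtain ⟨k, hk1, hk2⟩ := ((hp.eventually (Metric.closedBall_mem_nhds p ht0)).and
          (hσ.tendsto_atTop.eventually_ge_atTop N)).exists
        exact ⟨σ k, hk2, hk1⟩
      obtain ⟨n, hn, hnt⟩ := hnear
      obtain ⟨l, hl, hlD⟩ := hfar n
      by_contra! hcon
      have : ∀ j, n ≤ j → dist (x j) p ≤ t := by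
        intro j hj
        induction j, hj using Nat.le_induction with
        | base => exact hnt
        | succ j hj ih => exact hcon j (hn.trans hj) ih
      linarith [this l hl]
    choose ψ hψN hψ1 hψ2 using hcross
    have hψ : Tendsto ψ atTop atTop := tendsto_atTop_mono hψN tendsto_id
    obtain ⟨y, -, ρ, hρ, hy⟩ := hK.tendsto_subseq fun k => hx (ψ k)
    have hψρ := hψ.comp hρ.tendsto_atTop
    refine ⟨y, hcl y (ψ ∘ ρ) hψρ hy, ?_⟩
    have hd : Tendsto (fun k => dist (x (ψ (ρ k))) p) atTop (𝓝 (dist y p)) :=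
      (hy.dist tendsto_const_nhds)
    refine le_antisymm (le_of_tendsto' hd fun k => hψ1 _) ?_
    have hd2 : Tendsto (fun k => dist (x (ψ (ρ k) + 1)) (x (ψ (ρ k))) + dist (x (ψ (ρ k))) p)
        atTop (𝓝 (0 + dist y p)) := (hinc.comp hψρ).add hd
    rw [zero_add] at hd2
    exact ge_of_tendsto' hd2 fun k => (hψ2 _).le.trans (dist_triangle _ _ _)
  have hcount := (hZ.image fun y => dist y p).mono hlevel
  exact absurd hcount (by simpa using hD)

end Sequences

/-! ### Coordinatewise estimates for one step -/

section Algebra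

/-- The quadratic form which governs the drift of the Lyapunov function is negative. The `h * m`
terms, among them the one with coefficient `B`, which stems from the mismatch of the stepsizes, are
absorbed by the dissipation in both `m` and `h`. -/
theorem drift_coord_le {a P pmin η δ θ L γ A p m h K B : ℝ} (ha : 0 < a)
    (hγ : 0 < γ) (hpmin : 0 < pmin) (hp : pmin ≤ p) (hP : p ≤ P) (hA0 : a / 2 * γ ≤ A)
    (hA1 : A ≤ 2 * a * γ) (hB : |B| ≤ δ * γ) (hK : K ≤ -θ * γ) (hη : 0 < η) (hθ0 : 0 ≤ θ)
    (h1 : η * (8 * a + L) ≤ θ * pmin / 2) (h2 : δ * P ≤ θ * pmin) (h3 : δ * P ≤ η * a / 4) :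
    K * (p * m ^ 2) + B * (p * (m * h)) - η * A * h ^ 2 + η * A * (h * m) + η * L * γ * m ^ 2 ≤
      -(η * a / 4 * γ * h ^ 2) := by
  have hp0 : 0 < p := hpmin.trans_le hp
  have hP0 : 0 < P := hp0.trans_le hP
  have hA : 0 ≤ A := le_trans (by positivity) hA0
  have t1 : K * (p * m ^ 2) ≤ -θ * γ * (pmin * m ^ 2) := by
    have h4 : K * (p * m ^ 2) ≤ -θ * γ * (p * m ^ 2) :=
      mul_le_mul_of_nonneg_right hK (by positivity)
    have h5 : θ * γ * (pmin * m ^ 2) ≤ θ * γ * (p * m ^ 2) := by gcongr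
    linarith only [h4, h5]
  have t2 : B * (p * (m * h)) ≤ γ * (δ * P) * ((m ^ 2 + h ^ 2) / 2) := by
    have h4 : |m * h| ≤ (m ^ 2 + h ^ 2) / 2 := by
      rw [abs_le]; constructor <;> nlinarith only [sq_nonneg (m - h), sq_nonneg (m + h)]
    have h5 : 0 ≤ δ * γ := (abs_nonneg _).trans hB
    calc _ ≤ |B * (p * (m * h))| := le_abs_self _
      _ = |B| * (p * |m * h|) := by rw [abs_mul, abs_mul, abs_of_pos hp0]
      _ ≤ (δ * γ) * (P * ((m ^ 2 + h ^ 2) / 2)) := by gcongr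
      _ = _ := by ring
  have t3 : η * (a / 2 * γ) * h ^ 2 ≤ η * A * h ^ 2 := by gcongr
  have t4 : η * A * (h * m) ≤ η * γ * (a / 8 * h ^ 2 + 8 * a * m ^ 2) := by
    have h4 : h * m ≤ h ^ 2 / 16 + 4 * m ^ 2 := by nlinarith only [sq_nonneg (h / 4 - 2 * m)]
    calc η * A * (h * m) ≤ η * A * (h ^ 2 / 16 + 4 * m ^ 2) := by gcongr
      _ ≤ η * (2 * a * γ) * (h ^ 2 / 16 + 4 * m ^ 2) := by gcongr
      _ = _ := by ring
  have t5 := mul_le_mul_of_nonneg_left h1 (show 0 ≤ γ * m ^ 2 by positivity)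
  have t6 := mul_le_mul_of_nonneg_left h2 (show 0 ≤ γ * (m ^ 2 / 2) by positivity)
  have t7 := mul_le_mul_of_nonneg_left h3 (show 0 ≤ γ * (h ^ 2 / 2) by positivity)
  linarith only [t1, t2, t3, t4, t5, t6, t7]

/-- One step of the Lyapunov function, in one coordinate. Here `h` is the exact partial
derivative, `G` the stochastic one, `m`, `m'` the momenta, `p`, `p'` the preconditioners,
`q` the effective stepsize. -/
theorem lyapunov_step_coord {a P pmin η δ θ L γ q κ A p p' m m' G h : ℝ} (ha : 0 < a)
    (hγ : 0 < γ) (hpmin : 0 < pmin) (hp : pmin ≤ p) (hP : p ≤ P) (hκ : 0 ≤ κ)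
    (hp' : p' ≤ (1 + κ) * p) (hm' : m' = m + A * (G - m)) (hA0 : a / 2 * γ ≤ A)
    (hA1 : A ≤ 2 * a * γ) (hδ : |(1 + κ) * A / a - q| ≤ δ * γ)
    (hθ : (κ - 2 * A * (1 + κ)) / (2 * a) ≤ -θ * γ) (hη : 0 < η) (hθ0 : 0 ≤ θ)
    (h1 : η * (8 * a + L) ≤ θ * pmin / 2) (h2 : δ * P ≤ θ * pmin) (h3 : δ * P ≤ η * a / 4) :
    -(q * h * p * m) + (1 / (2 * a)) * (p' * m' ^ 2 - p * m ^ 2) - η * (A * (h * (G - m)))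
        + η * L * γ * m ^ 2 ≤
      -(η * a / 4 * γ * h ^ 2) + ((1 / a) * ((1 + κ) * A * p * m * (G - h)) - η * (A * h * (G - h)))
        + (1 + κ) * P / (2 * a) * (A ^ 2 * (G - m) ^ 2) := by
  have hdrift := drift_coord_le (m := m) (h := h) ha hγ hpmin hp hP hA0 hA1 hδ hθ hη hθ0 h1 h2 h3
  have e1 : p' * m' ^ 2 ≤ (1 + κ) * p * (m ^ 2 + 2 * A * m * (G - m)) +
      (1 + κ) * P * (A ^ 2 * (G - m) ^ 2) := by
    calc p' * m' ^ 2 ≤ (1 + κ) * p * m' ^ 2 := mul_le_mul_of_nonneg_right hp' (sq_nonneg _)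
      _ = (1 + κ) * p * (m ^ 2 + 2 * A * m * (G - m)) +
          (1 + κ) * p * (A ^ 2 * (G - m) ^ 2) := by rw [hm']; ring
      _ ≤ _ := by gcongr
  have e2 := mul_le_mul_of_nonneg_left (sub_le_sub_right e1 (p * m ^ 2))
    (show 0 ≤ 1 / (2 * a) by positivity)
  have key : -(q * h * p * m) + (1 / (2 * a)) * ((1 + κ) * p * (m ^ 2 + 2 * A * m * (G - m)) +
      (1 + κ) * P * (A ^ 2 * (G - m) ^ 2) - p * m ^ 2) - η * (A * (h * (G - m)))
        + η * L * γ * m ^ 2 =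
      ((κ - 2 * A * (1 + κ)) / (2 * a) * (p * m ^ 2) + ((1 + κ) * A / a - q) * (p * (m * h))
      - η * A * h ^ 2 + η * A * (h * m) + η * L * γ * m ^ 2)
      + ((1 / a) * ((1 + κ) * A * p * m * (G - h)) - η * (A * h * (G - h)))
        + (1 + κ) * P / (2 * a) * (A ^ 2 * (G - m) ^ 2) := by
    ring
  linarith only [key, e2, hdrift]

/-- The preconditioner increases by a controlled factor, whatever the stochastic gradient: the
second moment estimate decreases at most by the factor `1 - τ`, and
`(1 + τ / 2 + τ ^ 2) ^ 2 * (1 - τ) ≥ 1`. -/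
theorem preconditioner_le {ε v v' rb rb' β τ : ℝ} (hε : 0 < ε) (hv : 0 ≤ v) (hrb : 0 < rb)
    (hrb' : 0 < rb') (hrec : rb' = β * rb + (1 - β)) (hβ : β ≤ 1) (hv' : β * v ≤ v')
    (hτ : τ = (1 - β) / rb') (hτ2 : τ ≤ 1 / 2) :
    (ε + √(v' / rb'))⁻¹ ≤ (1 + (τ / 2 + τ ^ 2)) * (ε + √(v / rb))⁻¹ := by
  have hτ0 : 0 ≤ τ := by rw [hτ]; exact div_nonneg (sub_nonneg.2 hβ) hrb'.le
  set k := 1 + (τ / 2 + τ ^ 2) with hk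
  have hk1 : 1 ≤ k := by rw [hk]; nlinarith
  have hkey : 1 ≤ k ^ 2 * (1 - τ) := by
    have : k ^ 2 * (1 - τ) = 1 + τ ^ 2 * (5 / 4 - 5 / 4 * τ - τ ^ 3) := by rw [hk]; ring
    rw [this]
    have : τ ^ 3 ≤ (1 / 2) ^ 3 := by gcongr
    have : 0 ≤ τ ^ 2 * (5 / 4 - 5 / 4 * τ - τ ^ 3) := by
      refine mul_nonneg (sq_nonneg _) ?_
      nlinarith
    linarith
  have h1 : (1 - τ) * (v / rb) ≤ v' / rb' := by
    have : (1 - τ) * (v / rb) = β * v / rb' := by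
      rw [hτ]
      have : 1 - (1 - β) / rb' = β * rb / rb' := by
        rw [eq_div_iff hrb'.ne', sub_mul, div_mul_cancel₀ _ hrb'.ne', hrec]; ring
      rw [this]
      field_simp
    rw [this]
    gcongr
  have h2 : v / rb ≤ k ^ 2 * (v' / rb') := by
    have h0 : 0 ≤ v / rb := by positivity
    calc v / rb = 1 * (v / rb) := (one_mul _).symm
      _ ≤ (k ^ 2 * (1 - τ)) * (v / rb) := by gcongr
      _ = k ^ 2 * ((1 - τ) * (v / rb)) := by ring
      _ ≤ _ := by gcongr
  have h3 : √(v / rb) ≤ k * √(v' / rb') := by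
    calc √(v / rb) ≤ √(k ^ 2 * (v' / rb')) := Real.sqrt_le_sqrt h2
      _ = k * √(v' / rb') := by
        rw [Real.sqrt_mul (sq_nonneg _), Real.sqrt_sq (by linarith)]
  have hs := Real.sqrt_nonneg (v / rb)
  have hs' := Real.sqrt_nonneg (v' / rb')
  rw [← div_eq_mul_inv, inv_eq_one_div, div_le_div_iff₀ (by positivity) (by positivity)]
  nlinarith

end Algebra

/-! ### Asymptotics of the hyperparameters -/

section Stepsizes

variable {γ α β : ℕ → ℝ}

/-- The deterministic bias correction factors `r_n` (for the weights `α`) and `r̄_n` (for `β`). -/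
noncomputable def biasCorr (α : ℕ → ℝ) : ℕ → ℝ
  | 0 => 0
  | n + 1 => α (n + 1) * biasCorr α n + (1 - α (n + 1))

/-- The relative weight of the newest sample in the bias-corrected second moment estimate. -/
noncomputable def newestWeight (β : ℕ → ℝ) (n : ℕ) : ℝ :=
  (1 - β (n + 1)) / biasCorr β (n + 1)

/-- A bound for the relative growth of the preconditioner from step `n` to step `n + 1`. -/
noncomputable def precondGrowth (β : ℕ → ℝ) (n : ℕ) : ℝ :=
  newestWeight β n / 2 + newestWeight β n ^ 2

theorem tendsto_biasCorr (h0 : ∀ n ≥ 1, 0 ≤ α n ∧ α n ≤ 1)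
    (hsum : Tendsto (fun N => ∑ n ∈ Finset.range N, (1 - α (n + 1))) atTop atTop) :
    Tendsto (biasCorr α) atTop (𝓝 1) := by
  have h := tendsto_zero_of_contraction (u := fun n => 1 - biasCorr α n)
    (a := fun n => 1 - α (n + 1)) (e := 0) (w := 0)
    (fun n => by linarith [(h0 (n + 1) (by omega)).2])
    (fun n => by linarith [(h0 (n + 1) (by omega)).1]) hsum tendsto_const_nhds
    ⟨0, by simp⟩ (Eventually.of_forall fun n => by simp [biasCorr]; ring)
  simpa using h.const_sub 1

theorem Stepsizes.tendsto_sum_range (h : Stepsizes γ α β) :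
    Tendsto (fun N => ∑ n ∈ Finset.range N, γ (n + 1)) atTop atTop := by
  refine h.sum_eq_top.congr fun N => ?_
  rw [Finset.range_eq_Ico, Finset.sum_Ico_add' γ 0 N 1]
  rfl

theorem Stepsizes.tendsto_zero (h : Stepsizes γ α β) :
    Tendsto (fun n => γ (n + 1)) atTop (𝓝 0) := by
  have h1 := h.summable_sq.tendsto_atTop_zero
  have h2 := h1.sqrt
  rw [Real.sqrt_zero] at h2
  exact h2.congr fun n => Real.sqrt_sq (h.pos (n + 1) (by omega)).le

/-- Weights comparable to the stepsizes have a divergent sum. -/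
theorem Stepsizes.tendsto_sum_weights (h : Stepsizes γ α β) {w : ℕ → ℝ} {c : ℝ} (hc : 0 < c)
    (hw : Tendsto (fun n => (γ n)⁻¹ * w n) atTop (𝓝 c)) (hw0 : ∀ n ≥ 1, 0 ≤ w n) :
    Tendsto (fun N => ∑ n ∈ Finset.range N, w (n + 1)) atTop atTop := by
  have hnot : ¬ Summable fun n => w (n + 1) := by
    intro hs
    have hγ : Summable fun n => γ (n + 1) := by
      refine Summable.of_norm_bounded_eventually_nat (g := fun n => (c / 2)⁻¹ * w (n + 1))
        (hs.mul_left _) ?_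
      filter_upwards [(tendsto_add_atTop_nat 1).eventually
        (hw.eventually_const_lt (half_lt_self hc))] with n hn
      have hp := h.pos (n + 1) (by omega)
      rw [Real.norm_of_nonneg hp.le]
      rw [inv_mul_eq_div, lt_div_iff₀ hp] at hn
      rw [inv_mul_eq_div, le_div_iff₀ (by positivity)]
      linarith
    exact not_tendsto_atTop_of_tendsto_nhds hγ.hasSum.tendsto_sum_nat h.tendsto_sum_range
  exact (not_summable_iff_tendsto_nat_atTop_of_nonneg fun n => hw0 (n + 1) (by omega)).1 hnot

/-- Weights comparable to the stepsizes are square summable. -/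
theorem Stepsizes.summable_sq_weights (h : Stepsizes γ α β) {w : ℕ → ℝ} {c : ℝ}
    (hw : Tendsto (fun n => (γ (n + 1))⁻¹ * w n) atTop (𝓝 c)) : Summable fun n => w n ^ 2 := by
  obtain ⟨M, hM⟩ := (Metric.isBounded_range_of_tendsto _ hw).exists_norm_le
  refine Summable.of_nonneg_of_le (fun n => sq_nonneg _) (fun n => ?_)
    (h.summable_sq.mul_left (M ^ 2))
  have hp := h.pos (n + 1) (by omega)
  have h1 : |(γ (n + 1))⁻¹ * w n| ≤ M := hM _ ⟨n, rfl⟩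
  have h2 : w n = ((γ (n + 1))⁻¹ * w n) * γ (n + 1) := by field_simp
  calc w n ^ 2 = ((γ (n + 1))⁻¹ * w n) ^ 2 * γ (n + 1) ^ 2 := by rw [← mul_pow, ← h2]
    _ ≤ M ^ 2 * γ (n + 1) ^ 2 := by
      exact mul_le_mul_of_nonneg_right
        (sq_le_sq' (abs_le.1 h1).1 (abs_le.1 h1).2) (sq_nonneg _)

theorem Stepsizes.tendsto_biasCorr_alpha (h : Stepsizes γ α β) :
    Tendsto (biasCorr α) atTop (𝓝 1) := by
  obtain ⟨a, b, hb, hab, hα, -⟩ := h.limits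
  exact tendsto_biasCorr h.alpha_mem (h.tendsto_sum_weights (w := fun n => 1 - α n) (by linarith) hα
    fun n hn => by linarith [(h.alpha_mem n hn).2])

theorem Stepsizes.tendsto_biasCorr_beta (h : Stepsizes γ α β) :
    Tendsto (biasCorr β) atTop (𝓝 1) := by
  obtain ⟨a, b, hb, hab, -, hβ⟩ := h.limits
  exact tendsto_biasCorr h.beta_mem (h.tendsto_sum_weights (w := fun n => 1 - β n) hb hβ
    fun n hn => by linarith [(h.beta_mem n hn).2])

theorem Stepsizes.tendsto_shift (h : Stepsizes γ α β) {w : ℕ → ℝ} {c : ℝ}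
    (hw : Tendsto (fun n => (γ n)⁻¹ * w n) atTop (𝓝 c)) :
    Tendsto (fun n => (γ n)⁻¹ * w (n + 1)) atTop (𝓝 c) := by
  have h1 := ((tendsto_add_atTop_iff_nat 1).2 hw).mul h.ratio
  rw [mul_one] at h1
  refine h1.congr' ?_
  filter_upwards with n
  have hp := h.pos (n + 1) (by omega)
  field_simp

theorem Stepsizes.tendsto_newestWeight (h : Stepsizes γ α β) {b : ℝ}
    (hβ : Tendsto (fun n => (γ n)⁻¹ * (1 - β n)) atTop (𝓝 b)) :
    Tendsto (fun n => (γ n)⁻¹ * newestWeight β n) atTop (𝓝 b) := by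
  have h1 := (h.tendsto_shift (w := fun n => 1 - β n) hβ).div
    ((tendsto_add_atTop_iff_nat 1).2 h.tendsto_biasCorr_beta) one_ne_zero
  rw [div_one] at h1
  exact h1.congr fun n => mul_div_assoc _ _ _

theorem Stepsizes.tendsto_zero' (h : Stepsizes γ α β) : Tendsto γ atTop (𝓝 0) :=
  (tendsto_add_atTop_iff_nat 1).1 h.tendsto_zero

theorem Stepsizes.tendsto_zero_of_comparable (h : Stepsizes γ α β) {w : ℕ → ℝ} {c : ℝ}
    (hw : Tendsto (fun n => (γ n)⁻¹ * w n) atTop (𝓝 c)) : Tendsto w atTop (𝓝 0) := by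
  have h1 := hw.mul h.tendsto_zero'
  rw [mul_zero] at h1
  refine h1.congr' ?_
  filter_upwards [eventually_ge_atTop 1] with n hn
  have := h.pos n hn
  field_simp

theorem Stepsizes.tendsto_precondGrowth_div (h : Stepsizes γ α β) {b : ℝ}
    (hβ : Tendsto (fun n => (γ n)⁻¹ * (1 - β n)) atTop (𝓝 b)) :
    Tendsto (fun n => (γ n)⁻¹ * precondGrowth β n) atTop (𝓝 (b / 2)) := by
  have h1 := h.tendsto_newestWeight hβ
  have h2 := (h1.div_const 2).add (h1.mul (h.tendsto_zero_of_comparable h1))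
  rw [mul_zero, add_zero] at h2
  exact h2.congr fun n => by rw [precondGrowth]; ring

theorem Stepsizes.tendsto_precondGrowth (h : Stepsizes γ α β) :
    Tendsto (precondGrowth β) atTop (𝓝 0) := by
  obtain ⟨a, b, hb, hab, -, hβ⟩ := h.limits
  exact h.tendsto_zero_of_comparable (h.tendsto_precondGrowth_div hβ)

/-- The asymptotic relations between the hyperparameters which make the Lyapunov function
decrease. The constant `θ` is half of `1 - b / (4 a)`. -/
theorem Stepsizes.eventually_lyapunov (h : Stepsizes γ α β) : ∃ a θ : ℝ, 0 < a ∧ 0 < θ ∧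
    ∀ δ > 0, ∀ᶠ n in atTop, a / 2 * γ n ≤ 1 - α (n + 1) ∧ 1 - α (n + 1) ≤ 2 * a * γ n ∧
      |(1 + precondGrowth β n) * (1 - α (n + 1)) / a - γ n / biasCorr α n| ≤ δ * γ n ∧
      (precondGrowth β n - 2 * (1 - α (n + 1)) * (1 + precondGrowth β n)) / (2 * a) ≤
        -θ * γ n ∧
      newestWeight β n ≤ 1 / 2 ∧ 1 / 2 ≤ biasCorr α n ∧ 1 / 2 ≤ biasCorr β n := by
  obtain ⟨a, b, hb, hab, hα, hβ⟩ := h.limits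
  have ha : 0 < a := by linarith
  refine ⟨a, (1 - b / (4 * a)) / 2, ha, ?_, fun δ hδ => ?_⟩
  · have : b / (4 * a) < 1 := by rw [div_lt_one (by positivity)]; exact hab
    linarith
  have hA := h.tendsto_shift (w := fun n => 1 - α n) hα
  have hκ := h.tendsto_precondGrowth_div hβ
  have hκ0 := h.tendsto_precondGrowth
  have hτ := h.tendsto_zero_of_comparable (h.tendsto_newestWeight hβ)
  have hθ : (1 - b / (4 * a)) / 2 > 0 := by
    have : b / (4 * a) < 1 := by rw [div_lt_one (by positivity)]; exact hab
    linarith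
  have h1 : Tendsto (fun n => (1 + precondGrowth β n) * ((γ n)⁻¹ * (1 - α (n + 1))) / a -
      (biasCorr α n)⁻¹) atTop (𝓝 0) := by
    have := (((hκ0.const_add 1).mul hA).div_const a).sub
      (h.tendsto_biasCorr_alpha.inv₀ one_ne_zero)
    simpa [ha.ne'] using this
  have h2 : Tendsto (fun n => ((γ n)⁻¹ * precondGrowth β n -
      2 * ((γ n)⁻¹ * (1 - α (n + 1))) * (1 + precondGrowth β n)) / (2 * a)) atTop
      (𝓝 (-(1 - b / (4 * a)))) := by
    have := (hκ.sub ((hA.const_mul 2).mul (hκ0.const_add 1))).div_const (2 * a)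
    convert this using 2
    field_simp
    ring
  have hball := h1.eventually (Metric.ball_mem_nhds 0 hδ)
  filter_upwards [eventually_ge_atTop 1, hA.eventually_const_lt (half_lt_self ha),
    hA.eventually_lt_const (show a < 2 * a by linarith), hball,
    h2.eventually_lt_const (show -(1 - b / (4 * a)) < -((1 - b / (4 * a)) / 2) by linarith),
    hτ.eventually_lt_const (show (0 : ℝ) < 1 / 2 by norm_num),
    h.tendsto_biasCorr_alpha.eventually_const_lt (show (1 / 2 : ℝ) < 1 by norm_num),
    h.tendsto_biasCorr_beta.eventually_const_lt (show (1 / 2 : ℝ) < 1 by norm_num)]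
    with n hn e1 e2 e3 e4 e5 e6 e7
  have hp := h.pos n hn
  refine ⟨?_, ?_, ?_, ?_, e5.le, e6.le, e7.le⟩
  · rw [inv_mul_eq_div, lt_div_iff₀ hp] at e1; exact e1.le
  · rw [inv_mul_eq_div, div_lt_iff₀ hp] at e2; exact e2.le
  · rw [dist_zero_right, Real.norm_eq_abs] at e3
    have : (1 + precondGrowth β n) * (1 - α (n + 1)) / a - γ n / biasCorr α n =
        ((1 + precondGrowth β n) * ((γ n)⁻¹ * (1 - α (n + 1))) / a - (biasCorr α n)⁻¹) * γ n := by
      have : biasCorr α n ≠ 0 := by linarith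
      field_simp
    rw [this, abs_mul, abs_of_pos hp]
    gcongr
  · have : (precondGrowth β n - 2 * (1 - α (n + 1)) * (1 + precondGrowth β n)) / (2 * a) =
        (((γ n)⁻¹ * precondGrowth β n -
        2 * ((γ n)⁻¹ * (1 - α (n + 1))) * (1 + precondGrowth β n)) / (2 * a)) * γ n := by
      field_simp
    rw [this]
    gcongr

end Stepsizes

/-! ### Convergence of noise series -/

section Noise

variable {Ω Ξ E : Type*} {m mΩ : MeasurableSpace Ω} [MeasurableSpace Ξ] [MeasurableSpace E]
  {P : Measure Ω} [IsProbabilityMeasure P] {μ : Measure Ξ}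

/-- A variable known to a `σ`-algebra and a fresh sample have a product law. -/
theorem map_prodMk_of_indep (hm : m ≤ mΩ) {Y : Ω → E}
    (hY : Measurable[m] Y) {ζ : Ω → Ξ} (hζ : Measurable ζ) (hlaw : P.map ζ = μ)
    (hind : Indep m (MeasurableSpace.comap ζ inferInstance) P) :
    P.map (fun ω => (Y ω, ζ ω)) = (P.map Y).prod μ := by
  have hYm : Measurable Y := hY.mono hm le_rfl
  have h : IndepFun Y ζ P := by
    rw [IndepFun_iff_Indep]
    exact indep_of_indep_of_le_left hind hY.comap_le
  rw [(indepFun_iff_map_prod_eq_prod_map_map hYm.aemeasurable hζ.aemeasurable).1 h, hlaw]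

variable [IsProbabilityMeasure μ]

/-- Averaging over a fresh sample: if `Φ(y, ·)` is centred for all `y`, then `Φ(Y, ζ)` is centred
for every `Y` independent of `ζ`. (When `Φ(Y, ζ)` is not integrable, its integral is `0` by
convention.) -/
theorem integral_comp_eq_zero (hm : m ≤ mΩ) {Y : Ω → E}
    (hY : Measurable[m] Y) {ζ : Ω → Ξ} (hζ : Measurable ζ) (hlaw : P.map ζ = μ)
    (hind : Indep m (MeasurableSpace.comap ζ inferInstance) P) {Φ : E × Ξ → ℝ}
    (hΦ : Measurable Φ) (h0 : ∀ y, ∫ s, Φ (y, s) ∂μ = 0) : ∫ ω, Φ (Y ω, ζ ω) ∂P = 0 := by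
  have hYm : Measurable Y := hY.mono hm le_rfl
  rw [← integral_map (φ := fun ω => (Y ω, ζ ω)) (f := Φ) (hYm.prodMk hζ).aemeasurable
    hΦ.aestronglyMeasurable, map_prodMk_of_indep hm hY hζ hlaw hind]
  by_cases hi : Integrable Φ ((P.map Y).prod μ)
  · rw [integral_prod _ hi]; simp [h0]
  · exact integral_undef hi

theorem lintegral_comp_eq (hm : m ≤ mΩ) {Y : Ω → E}
    (hY : Measurable[m] Y) {ζ : Ω → Ξ} (hζ : Measurable ζ) (hlaw : P.map ζ = μ)
    (hind : Indep m (MeasurableSpace.comap ζ inferInstance) P) {Φ : E × Ξ → ℝ≥0∞}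
    (hΦ : Measurable Φ) : ∫⁻ ω, Φ (Y ω, ζ ω) ∂P = ∫⁻ ω, ∫⁻ s, Φ (Y ω, s) ∂μ ∂P := by
  have hYm : Measurable Y := hY.mono hm le_rfl
  rw [← lintegral_map (g := fun ω => (Y ω, ζ ω)) hΦ (hYm.prodMk hζ),
    map_prodMk_of_indep hm hY hζ hlaw hind, lintegral_prod _ hΦ.aemeasurable,
    lintegral_map hΦ.lintegral_prod_right' hYm]

/-- A series of centred square integrable noise terms, sampled along an adapted sequence with
square summable predictable weights, converges almost surely: its partial sums are a martingale
bounded in `L²`. -/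
theorem ae_exists_tendsto_noise {ℱ : Filtration ℕ mΩ} {X : ℕ → Ω → E}
    (hX : ∀ n, Measurable[ℱ n] (X n)) {ζ : ℕ → Ω → Ξ} (hζ : ∀ n, Measurable[ℱ (n + 1)] (ζ n))
    (hlaw : ∀ n, P.map (ζ n) = μ)
    (hind : ∀ n, Indep (ℱ n) (MeasurableSpace.comap (ζ n) inferInstance) P)
    {w : ℕ → Ω → ℝ} (hw : ∀ n, Measurable[ℱ n] (w n)) {c : ℕ → ℝ}
    (hwc : ∀ n ω, |w n ω| ≤ c n) (hc : Summable fun n => c n ^ 2) {h : E → Ξ → ℝ}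
    (hmeas : Measurable fun q : E × Ξ => h q.1 q.2) (h0 : ∀ x, ∫ s, h x s ∂μ = 0) {C : ℝ≥0∞}
    (hC : C < ∞) (h2 : ∀ x, ∫⁻ s, ‖h x s‖ₑ ^ 2 ∂μ ≤ C) :
    ∀ᵐ ω ∂P, ∃ l, Tendsto (fun N => ∑ n ∈ Finset.range N, w n ω * h (X n ω) (ζ n ω)) atTop
      (𝓝 l) := by
  have hζm : ∀ n, Measurable (ζ n) := fun n => (hζ n).mono (ℱ.le _) le_rfl
  set D : ℕ → Ω → ℝ := fun n ω => w n ω * h (X n ω) (ζ n ω) with hD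
  have hDm : ∀ n, Measurable[ℱ (n + 1)] (D n) := fun n =>
    ((hw n).mono (ℱ.mono n.le_succ) le_rfl).mul
      (hmeas.comp (((hX n).mono (ℱ.mono n.le_succ) le_rfl).prodMk (hζ n)))
  have hc0 : ∀ n, 0 ≤ c n := fun n => by
    obtain ⟨ω⟩ : Nonempty Ω := nonempty_of_isProbabilityMeasure P
    exact (abs_nonneg _).trans (hwc n ω)
  -- Second moment of a single term.
  have hD2 : ∀ n, ∫⁻ ω, ‖D n ω‖ₑ ^ 2 ∂P ≤ ENNReal.ofReal (c n ^ 2) * C := by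
    intro n
    calc ∫⁻ ω, ‖D n ω‖ₑ ^ 2 ∂P ≤ ∫⁻ ω, ENNReal.ofReal (c n ^ 2) * ‖h (X n ω) (ζ n ω)‖ₑ ^ 2 ∂P := by
          refine lintegral_mono fun ω => ?_
          simp only [hD, enorm_mul, mul_pow]
          gcongr
          rw [ENNReal.ofReal_pow (hc0 n)]
          gcongr
          rw [← ofReal_norm]
          exact ENNReal.ofReal_le_ofReal (hwc n ω)
      _ = ENNReal.ofReal (c n ^ 2) * ∫⁻ ω, ∫⁻ s, ‖h (X n ω) s‖ₑ ^ 2 ∂μ ∂P := by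
          rw [lintegral_const_mul' _ _ (by simp)]
          congr 1
          exact lintegral_comp_eq (Φ := fun q : E × Ξ => ‖h q.1 q.2‖ₑ ^ 2) (ℱ.le n) (hX n) (hζm n)
            (hlaw n) (hind n) (hmeas.enorm.pow_const 2)
      _ ≤ ENNReal.ofReal (c n ^ 2) * ∫⁻ _, C ∂P := by
          gcongr with ω
          exact h2 _
      _ = _ := by simp
  have hDL : ∀ n, MemLp (D n) 2 P := fun n => by
    refine ⟨((hDm n).mono (ℱ.le _) le_rfl).aestronglyMeasurable, ?_⟩
    rw [eLpNorm_lt_top_iff_lintegral_rpow_enorm_lt_top (by norm_num) (by norm_num)]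
    simpa using (hD2 n).trans_lt (ENNReal.mul_lt_top ENNReal.ofReal_lt_top hC)
  have hDint : ∀ n, ∫ ω, D n ω ^ 2 ∂P ≤ c n ^ 2 * C.toReal := by
    intro n
    rw [integral_eq_lintegral_of_nonneg_ae (Eventually.of_forall fun ω => sq_nonneg _)
      (hDL n).integrable_sq.1]
    have h3 := ENNReal.toReal_mono (ENNReal.mul_lt_top ENNReal.ofReal_lt_top hC).ne (hD2 n)
    rw [ENNReal.toReal_mul, ENNReal.toReal_ofReal (sq_nonneg _)] at h3
    refine le_trans (le_of_eq ?_) h3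
    congr 1
    refine lintegral_congr fun ω => ?_
    rw [← ofReal_norm, ← ENNReal.ofReal_pow (norm_nonneg _), Real.norm_eq_abs, sq_abs]
  -- Each term is orthogonal to the past.
  have horth : ∀ n (Z : Ω → ℝ), Measurable[ℱ n] Z → ∫ ω, Z ω * D n ω ∂P = 0 := by
    intro n Z hZ
    have h3 := integral_comp_eq_zero (Φ := fun q : (ℝ × E) × Ξ => q.1.1 * h q.1.2 q.2)
      (ℱ.le n) ((hZ.mul (hw n)).prodMk (hX n)) (hζm n) (hlaw n) (hind n) ?_ ?_
    · simpa only [hD, Pi.mul_apply, mul_assoc] using h3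
    · exact (measurable_fst.comp measurable_fst).mul
        (hmeas.comp ((measurable_snd.comp measurable_fst).prodMk measurable_snd))
    · intro y
      simp [integral_const_mul, h0]
  set M : ℕ → Ω → ℝ := fun N ω => ∑ n ∈ Finset.range N, D n ω with hM
  have hMs : ∀ N, M (N + 1) = fun ω => M N ω + D N ω := fun N => by
    ext ω; simp only [hM, Finset.sum_range_succ]
  have hMm : ∀ N, Measurable[ℱ N] (M N) := by
    intro N
    refine Finset.measurable_sum _ fun n hn => ?_
    exact (hDm n).mono (ℱ.mono (Finset.mem_range.1 hn)) le_rfl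
  have hML : ∀ N, MemLp (M N) 2 P := fun N => memLp_finsetSum _ fun n _ => hDL n
  have hM2 : ∀ N, ∫ ω, M N ω ^ 2 ∂P ≤ ∑ n ∈ Finset.range N, c n ^ 2 * C.toReal := by
    intro N
    induction N with
    | zero => simp [hM]
    | succ N ih =>
      have hprod : Integrable (fun ω => M N ω * D N ω) P := (hML N).integrable_mul (hDL N)
      have h4 : ∫ ω, M (N + 1) ω ^ 2 ∂P =
          ∫ ω, M N ω ^ 2 ∂P + 2 * ∫ ω, M N ω * D N ω ∂P + ∫ ω, D N ω ^ 2 ∂P := by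
        rw [← integral_const_mul, ← integral_add (hML N).integrable_sq (hprod.const_mul 2),
          ← integral_add (f := fun ω => M N ω ^ 2 + 2 * (M N ω * D N ω))
            ((hML N).integrable_sq.add (hprod.const_mul 2)) (hDL N).integrable_sq]
        refine integral_congr_ae (Eventually.of_forall fun ω => ?_)
        simp only [hMs]
        ring
      rw [h4, horth N _ (hMm N), Finset.sum_range_succ]
      linarith [hDint N]
  have hmart : Martingale M ℱ P := by
    refine martingale_of_setIntegral_eq_succ (fun N => (hMm N).stronglyMeasurable)
      (fun N => (hML N).integrable (by norm_num)) fun N A hA => ?_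
    rw [hMs, integral_add ((hML N).integrable (by norm_num)).integrableOn
      ((hDL N).integrable (by norm_num)).integrableOn]
    have h5 := horth N (A.indicator 1) (measurable_const.indicator hA)
    have h6 : (fun ω => A.indicator (1 : Ω → ℝ) ω * D N ω) = A.indicator (D N) := by
      ext ω
      by_cases hω : ω ∈ A <;> simp [hω]
    rw [h6, integral_indicator (ℱ.le N _ hA)] at h5
    rw [h5, add_zero]
  refine hmart.submartingale.exists_ae_tendsto_of_bdd
    (R := (1 + (∑' n, c n ^ 2) * C.toReal).toNNReal) fun N => ?_
  rw [eLpNorm_one_eq_lintegral_enorm, ← ofReal_integral_norm_eq_lintegral_enorm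
    ((hML N).integrable (by norm_num))]
  refine ENNReal.ofReal_le_ofReal ?_
  calc ∫ ω, ‖M N ω‖ ∂P ≤ ∫ ω, (1 + M N ω ^ 2) ∂P := by
        refine integral_mono ((hML N).integrable (by norm_num)).norm
          ((integrable_const 1).add (hML N).integrable_sq) fun ω => ?_
        simp only [Real.norm_eq_abs]
        rw [← sq_abs (M N ω)]
        nlinarith [sq_nonneg (|M N ω| - 1), abs_nonneg (M N ω)]
    _ = 1 + ∫ ω, M N ω ^ 2 ∂P := by
        rw [integral_add (integrable_const 1) (hML N).integrable_sq]; simp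
    _ ≤ 1 + ∑ n ∈ Finset.range N, c n ^ 2 * C.toReal := by gcongr; exact hM2 N
    _ ≤ _ := by
        rw [← Finset.sum_mul]
        gcongr
        exact hc.sum_le_tsum _ fun n _ => sq_nonneg _

/-- A series of nonnegative terms with summable weights and bounded means converges. -/
theorem ae_summable_of_lintegral_le {ℱ : Filtration ℕ mΩ} {X : ℕ → Ω → E}
    (hX : ∀ n, Measurable[ℱ n] (X n)) {ζ : ℕ → Ω → Ξ} (hζ : ∀ n, Measurable (ζ n))
    (hlaw : ∀ n, P.map (ζ n) = μ)
    (hind : ∀ n, Indep (ℱ n) (MeasurableSpace.comap (ζ n) inferInstance) P)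
    {c : ℕ → ℝ} (hc0 : ∀ n, 0 ≤ c n) (hc : Summable c) {h : E → Ξ → ℝ}
    (hmeas : Measurable fun q : E × Ξ => h q.1 q.2) (hh : ∀ x s, 0 ≤ h x s) {C : ℝ≥0∞}
    (hC : C < ∞) (h1 : ∀ x, ∫⁻ s, ENNReal.ofReal (h x s) ∂μ ≤ C) :
    ∀ᵐ ω ∂P, Summable fun n => c n * h (X n ω) (ζ n ω) := by
  have hm : ∀ n, Measurable fun ω => ENNReal.ofReal (c n * h (X n ω) (ζ n ω)) := fun n =>
    (measurable_const.mul (hmeas.comp (((hX n).mono (ℱ.le _) le_rfl).prodMk (hζ n)))).ennreal_ofReal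
  have hfin : ∫⁻ ω, ∑' n, ENNReal.ofReal (c n * h (X n ω) (ζ n ω)) ∂P < ∞ := by
    rw [lintegral_tsum fun n => (hm n).aemeasurable]
    calc ∑' n, ∫⁻ ω, ENNReal.ofReal (c n * h (X n ω) (ζ n ω)) ∂P
        ≤ ∑' n, ENNReal.ofReal (c n) * C := by
          refine ENNReal.tsum_le_tsum fun n => ?_
          simp_rw [ENNReal.ofReal_mul (hc0 n)]
          rw [lintegral_const_mul' _ _ ENNReal.ofReal_ne_top,
            lintegral_comp_eq (μ := μ) (Φ := fun q : E × Ξ => ENNReal.ofReal (h q.1 q.2))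
              (ℱ.le n) (hX n) (hζ n) (hlaw n) (hind n) hmeas.ennreal_ofReal]
          refine mul_le_mul_right ?_ _
          calc _ ≤ ∫⁻ _, C ∂P := lintegral_mono fun ω => h1 _
            _ = C := by simp
      _ = (∑' n, ENNReal.ofReal (c n)) * C := ENNReal.tsum_mul_right
      _ < ∞ := by
          rw [← ENNReal.ofReal_tsum_of_nonneg hc0 hc]
          exact ENNReal.mul_lt_top ENNReal.ofReal_lt_top hC
  filter_upwards [ae_lt_top (Measurable.tsum hm) hfin.ne] with ω hω
  have h3 := ENNReal.summable_toReal hω.ne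
  refine h3.congr fun n => ?_
  exact ENNReal.toReal_ofReal (mul_nonneg (hc0 n) (hh _ _))

end Noise

/-! ### Bounded trajectories with convergent noise -/

section Path

variable {d : ℕ} {Ξ : Type*} [MeasurableSpace Ξ] {f : Vec d → Ξ → ℝ} {μ : Measure Ξ}
  {ε R : ℝ} {γ α β : ℕ → ℝ} {x m v G : ℕ → Vec d}

/-- The diagonal entries of the preconditioner `1 / (ε + √v̂_n)`. -/
noncomputable def precond (ε : ℝ) (β : ℕ → ℝ) (v : ℕ → Vec d) (n : ℕ) (i : Fin d) : ℝ :=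
  (ε + √(v n i / biasCorr β n))⁻¹

/-- A bounded trajectory `(x_n, m_n, v_n)` of the algorithm driven by arbitrary vectors `G_n`, the
stochastic gradients at `x_n` used for the step from `n` to `n + 1`. -/
structure AdamPath (ε R : ℝ) (γ α β : ℕ → ℝ) (x m v G : ℕ → Vec d) : Prop where
  x_succ : ∀ n i, x (n + 1) i =
    x n i - γ (n + 1) / biasCorr α (n + 1) * precond ε β v (n + 1) i * m (n + 1) i
  m_succ : ∀ n i, m (n + 1) i = m n i + (1 - α (n + 1)) * (G n i - m n i)
  v_succ : ∀ n i, v (n + 1) i = v n i + (1 - β (n + 1)) * (G n i ^ 2 - v n i)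
  v_nonneg : ∀ n i, 0 ≤ v n i
  x_le : ∀ n, ‖x n‖ ≤ R
  m_le : ∀ n, ‖m n‖ ≤ R
  v_le : ∀ n, ‖v n‖ ≤ R

/-- The series of noise terms met in the analysis of a trajectory converge. -/
structure NoiseConverges (f : Vec d → Ξ → ℝ) (μ : Measure Ξ) (ε : ℝ) (γ α β : ℕ → ℝ)
    (x m v G : ℕ → Vec d) : Prop where
  first : ∀ i, ∃ l, Tendsto (fun N => ∑ n ∈ Finset.range N,
    (1 - α (n + 1)) * (G n i - gradient (F f μ) (x n) i)) atTop (𝓝 l)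
  second : ∀ i, ∃ l, Tendsto (fun N => ∑ n ∈ Finset.range N,
    (1 - β (n + 1)) * (G n i ^ 2 - S f μ (x n) i)) atTop (𝓝 l)
  quad : ∀ i, ∃ l, Tendsto (fun N => ∑ n ∈ Finset.range N,
    (1 + precondGrowth β n) * (1 - α (n + 1)) * precond ε β v n i * m n i *
      (G n i - gradient (F f μ) (x n) i)) atTop (𝓝 l)
  cross : ∀ i, ∃ l, Tendsto (fun N => ∑ n ∈ Finset.range N,
    (1 - α (n + 1)) * gradient (F f μ) (x n) i *
      (G n i - gradient (F f μ) (x n) i)) atTop (𝓝 l)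
  square : Summable fun n => γ n ^ 2 * ‖G n‖ ^ 2

theorem precond_nonneg (hε : 0 < ε) (n : ℕ) (i : Fin d) : 0 ≤ precond ε β v n i := by
  rw [precond]; positivity

theorem precond_le (hε : 0 < ε) (n : ℕ) (i : Fin d) : precond ε β v n i ≤ ε⁻¹ := by
  rw [precond]
  gcongr
  simp

theorem norm_le_of_forall_abs_le {u w : Vec d} {c : ℝ} (hc : 0 ≤ c)
    (h : ∀ i, |u i| ≤ c * |w i|) : ‖u‖ ≤ c * ‖w‖ := by
  refine abs_le_of_sq_le_sq' ?_ (by positivity) |>.2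
  rw [mul_pow, EuclideanSpace.real_norm_sq_eq, EuclideanSpace.real_norm_sq_eq, Finset.mul_sum]
  refine Finset.sum_le_sum fun i _ => ?_
  rw [← sq_abs, ← sq_abs (w i), ← mul_pow]
  gcongr
  exact h i

theorem AdamPath.eventually_norm_x_sub_le (hp : AdamPath ε R γ α β x m v G) (hε : 0 < ε)
    (hs : Stepsizes γ α β) :
    ∀ᶠ n in atTop, ‖x (n + 1) - x n‖ ≤ 2 / ε * γ (n + 1) * ‖m (n + 1)‖ := by
  filter_upwards [(tendsto_add_atTop_nat 1).eventually
    (hs.tendsto_biasCorr_alpha.eventually_const_lt (show (1 / 2 : ℝ) < 1 by norm_num))] with n hn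
  have hγ := hs.pos (n + 1) (by omega)
  refine norm_le_of_forall_abs_le (by positivity) fun i => ?_
  have h1 : (x (n + 1) - x n) i =
      -(γ (n + 1) / biasCorr α (n + 1) * precond ε β v (n + 1) i * m (n + 1) i) := by
    simp [hp.x_succ n i]
  have h2 : γ (n + 1) / biasCorr α (n + 1) ≤ 2 * γ (n + 1) := by
    rw [div_le_iff₀ (by linarith)]; nlinarith
  have h3 : 0 ≤ γ (n + 1) / biasCorr α (n + 1) := div_nonneg hγ.le (by linarith)
  rw [h1, abs_neg, abs_mul, abs_mul, abs_of_nonneg h3, abs_of_nonneg (precond_nonneg hε _ _)]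
  calc _ ≤ 2 * γ (n + 1) * ε⁻¹ * |m (n + 1) i| := by
        gcongr
        · exact precond_nonneg hε _ _
        · exact precond_le hε _ _
    _ = _ := by ring

theorem Stepsizes.eventually_le_two_mul (hs : Stepsizes γ α β) :
    ∀ᶠ n in atTop, γ (n + 1) ≤ 2 * γ n ∧ γ n ≤ 2 * γ (n + 1) := by
  filter_upwards [eventually_ge_atTop 1,
    hs.ratio.eventually_lt_const (show (1 : ℝ) < 2 by norm_num),
    hs.ratio.eventually_const_lt (show (1 / 2 : ℝ) < 1 by norm_num)] with n hn h1 h2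
  have := hs.pos n hn
  rw [div_lt_iff₀ this] at h1
  rw [lt_div_iff₀ this] at h2
  constructor <;> linarith

/-- The Lyapunov function `F(x_n) + ‖m_{n+1}‖² / (2 a) - η ⟨∇F(x_n), m_{n+1}⟩`, where the norm of
the momentum is weighted by the preconditioner. Pairing `x_n` with `m_{n+1}` makes the step of `x`
predictable, and the inner product adds a dissipation in `‖∇F(x_n)‖²`. -/
noncomputable def lyapunov (f : Vec d → Ξ → ℝ) (μ : Measure Ξ) (ε a η : ℝ) (β : ℕ → ℝ)
    (x m v : ℕ → Vec d) (n : ℕ) : ℝ :=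
  F f μ (x n) + ∑ i, (1 / (2 * a) * (precond ε β v (n + 1) i * m (n + 1) i ^ 2) -
    η * (gradient (F f μ) (x n) i * m (n + 1) i))

/-- The descent inequality for the objective, with the gradient taken at the end point. -/
theorem AdamPath.descent (hp : AdamPath ε R γ α β x m v G) (hε : 0 < ε) {L : ℝ} (hL : 0 < L)
    {n : ℕ} (h : |F f μ (x n) - F f μ (x (n + 1)) -
      inner ℝ (gradient (F f μ) (x (n + 1))) (x n - x (n + 1))| ≤ L * ‖x n - x (n + 1)‖ ^ 2)
    (hΔ : ‖x (n + 1) - x n‖ ≤ 2 / ε * γ (n + 1) * ‖m (n + 1)‖) (hγ : 0 < γ (n + 1)) :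
    F f μ (x (n + 1)) - F f μ (x n) ≤
      ∑ i, -(γ (n + 1) / biasCorr α (n + 1) * gradient (F f μ) (x (n + 1)) i *
        precond ε β v (n + 1) i * m (n + 1) i) + L * (2 / ε * R) ^ 2 * γ (n + 1) ^ 2 := by
  have hΔR : ‖x (n + 1) - x n‖ ≤ 2 / ε * R * γ (n + 1) := by
    refine hΔ.trans ?_
    calc _ ≤ 2 / ε * γ (n + 1) * R := by gcongr; exact hp.m_le _
      _ = _ := by ring
  have h4 := (abs_le.1 h).1
  have h5 : inner ℝ (gradient (F f μ) (x (n + 1))) (x n - x (n + 1)) =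
      -∑ i, -(γ (n + 1) / biasCorr α (n + 1) * gradient (F f μ) (x (n + 1)) i *
        precond ε β v (n + 1) i * m (n + 1) i) := by
    rw [PiLp.inner_apply, ← Finset.sum_neg_distrib]
    refine Finset.sum_congr rfl fun i _ => ?_
    simp only [PiLp.sub_apply, hp.x_succ n i, RCLike.inner_apply, conj_trivial]
    ring
  have h6 : L * ‖x n - x (n + 1)‖ ^ 2 ≤ L * (2 / ε * R) ^ 2 * γ (n + 1) ^ 2 := by
    rw [norm_sub_rev, mul_assoc, ← mul_pow]
    gcongr
  rw [h5] at h4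
  linarith

/-- The change of the gradient in the inner product `⟨∇F(x_n), m_{n+1}⟩` is of the order of the
dissipation in the momentum. -/
theorem neg_sum_sub_mul_le {g g' w : Vec d} {L c Δ : ℝ} (hL : 0 < L) (hg : ‖g' - g‖ ≤ L * Δ)
    (hΔ : Δ ≤ c * ‖w‖) : -∑ i, (g' i - g i) * w i ≤ L * c * ∑ i, w i ^ 2 := by
  have h4 : ∑ i, (g' i - g i) * w i = inner ℝ w (g' - g) := by
    rw [PiLp.inner_apply]; simp
  rw [h4, ← EuclideanSpace.real_norm_sq_eq]
  calc _ ≤ ‖w‖ * ‖g' - g‖ := (neg_le_abs _).trans (abs_real_inner_le_norm _ _)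
    _ ≤ ‖w‖ * (L * (c * ‖w‖)) := by
        gcongr
        exact hg.trans (by gcongr)
    _ = _ := by ring

theorem AdamPath.lyapunov_succ_sub (hp : AdamPath ε R γ α β x m v G) {a η : ℝ} (n : ℕ) :
    lyapunov f μ ε a η β x m v (n + 1) - lyapunov f μ ε a η β x m v n =
      (F f μ (x (n + 1)) - F f μ (x n)) +
      ∑ i, ((1 / (2 * a)) * (precond ε β v (n + 1 + 1) i * m (n + 1 + 1) i ^ 2 -
        precond ε β v (n + 1) i * m (n + 1) i ^ 2) -
        η * ((1 - α (n + 1 + 1)) * (gradient (F f μ) (x (n + 1)) i *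
          (G (n + 1) i - m (n + 1) i)))) +
      η * (-∑ i, (gradient (F f μ) (x (n + 1)) i - gradient (F f μ) (x n) i) * m (n + 1) i) := by
  have h4 : ∀ s t : ℝ, ∀ u w : Fin d → ℝ, (s + ∑ i, u i) - (t + ∑ i, w i) =
      (s - t) + ∑ i, (u i - w i) := fun s t u w => by
    rw [Finset.sum_sub_distrib]; ring
  rw [lyapunov, lyapunov, h4, add_assoc (F f μ (x (n + 1)) - F f μ (x n)),
    ← Finset.sum_neg_distrib, Finset.mul_sum, ← Finset.sum_add_distrib]
  congr 1
  refine Finset.sum_congr rfl fun i _ => ?_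
  have h5 := hp.m_succ (n + 1) i
  have h6 : (1 - α (n + 1 + 1)) * (gradient (F f μ) (x (n + 1)) i *
      (G (n + 1) i - m (n + 1) i)) =
      gradient (F f μ) (x (n + 1)) i * (m (n + 1 + 1) i - m (n + 1) i) := by rw [h5]; ring
  rw [h6]
  ring

variable [IsProbabilityMeasure μ]

theorem AdamPath.exists_abs_lyapunov_le (hp : AdamPath ε R γ α β x m v G) (hε : 0 < ε)
    (hf : Model f μ) (hmom : LocMoment f μ 4) {a η : ℝ} (ha : 0 < a) (hη : 0 < η) :
    ∃ B, ∀ n, |lyapunov f μ ε a η β x m v n| ≤ B := by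
  have hK := isCompact_closedBall (0 : Vec d) R
  obtain ⟨B₁, h₁⟩ := hK.exists_bound_of_continuousOn (hf.continuous_F hmom).continuousOn
  obtain ⟨B₂, h₂⟩ := hK.exists_bound_of_continuousOn (hf.continuous_gradient_F hmom).continuousOn
  have hx : ∀ n, x n ∈ Metric.closedBall (0 : Vec d) R := fun n => by simpa using hp.x_le n
  refine ⟨B₁ + ∑ _i : Fin d, (1 / (2 * a) * (ε⁻¹ * R ^ 2) + η * (B₂ * R)), fun n => ?_⟩
  refine (abs_add_le _ _).trans (add_le_add (h₁ _ (hx n)) ?_)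
  refine (Finset.abs_sum_le_sum_abs _ _).trans (Finset.sum_le_sum fun i _ => ?_)
  have hm : |m (n + 1) i| ≤ R := (PiLp.norm_apply_le (m (n + 1)) i).trans (hp.m_le _)
  have hg : |gradient (F f μ) (x n) i| ≤ B₂ := (PiLp.norm_apply_le _ i).trans (h₂ _ (hx n))
  have hR : 0 ≤ R := (abs_nonneg _).trans hm
  have hB : 0 ≤ B₂ := (abs_nonneg _).trans hg
  refine (abs_sub _ _).trans (add_le_add ?_ ?_)
  · rw [abs_mul, abs_mul, abs_of_nonneg (precond_nonneg hε _ _), abs_of_pos (by positivity),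
      abs_pow]
    gcongr
    exact precond_le hε _ _
  · rw [abs_mul, abs_mul, abs_of_pos hη]
    gcongr

/-- The Lyapunov function decreases along bounded trajectories, up to noise. -/
theorem AdamPath.summable_gradient_sq (hp : AdamPath ε R γ α β x m v G) (hε : 0 < ε)
    (hf : Model f μ) (hmom : LocMoment f μ 4) (hs : Stepsizes γ α β)
    (hn : NoiseConverges f μ ε γ α β x m v G) :
    Summable fun n => γ (n + 1) * ‖gradient (F f μ) (x (n + 1))‖ ^ 2 := by
  obtain ⟨a, θ, ha, hθ, hev⟩ := hs.eventually_lyapunov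
  obtain ⟨L, hL, hLip⟩ := hf.exists_lipschitz_gradient_F hmom R
  have hx : ∀ n, x n ∈ Metric.closedBall (0 : Vec d) R := fun n => by simpa using hp.x_le n
  have hR : 0 ≤ R := (norm_nonneg _).trans (hp.m_le 0)
  -- A lower bound for the preconditioner once `r̄_n ≥ 1 / 2`.
  set pmin : ℝ := (ε + √(2 * R))⁻¹ with hpmin
  have hpmin0 : 0 < pmin := by positivity
  -- `η` is so small that the terms which the inner product brings in are dominated by the
  -- dissipation `θ` of the momentum, and `δ` is small with respect to both dissipations.
  set η : ℝ := θ * pmin / 2 / (8 * a + L * (2 / ε)) with hη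
  have hη0 : 0 < η := by positivity
  set δ : ℝ := min (θ * pmin) (η * a / 4) * ε with hδ
  have hδ0 : 0 < δ := by positivity
  have h1 : η * (8 * a + L * (2 / ε)) ≤ θ * pmin / 2 := by
    rw [hη, div_mul_cancel₀ _ (by positivity)]
  have h23 : δ * ε⁻¹ = min (θ * pmin) (η * a / 4) := by rw [hδ]; field_simp
  have h2 : δ * ε⁻¹ ≤ θ * pmin := h23 ▸ min_le_left _ _
  have h3 : δ * ε⁻¹ ≤ η * a / 4 := h23 ▸ min_le_right _ _
  obtain ⟨B, hB⟩ := hp.exists_abs_lyapunov_le hε hf hmom ha hη0 (f := f) (μ := μ)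
  set g : ℕ → Vec d := fun n => gradient (F f μ) (x n) with hg
  set ν : ℕ → ℝ := fun n => ∑ i, ((1 / a) * ((1 + precondGrowth β n) * (1 - α (n + 1)) *
    precond ε β v n i * m n i * (G n i - g n i)) -
    η * ((1 - α (n + 1)) * g n i * (G n i - g n i))) with hν
  set E : ℕ → ℝ := fun n => L * (2 / ε * R) ^ 2 * γ n ^ 2 +
    2 * ε⁻¹ / (2 * a) * ((2 * a) ^ 2 * (2 * (γ n ^ 2 * ‖G n‖ ^ 2) + 2 * R ^ 2 * γ n ^ 2)) with hE
  have hγ2 : Summable fun n => γ n ^ 2 := (summable_nat_add_iff 1).1 hs.summable_sq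
  have hEs : Summable E := (hγ2.mul_left _).add
    ((((hn.square.mul_left 2).add (hγ2.mul_left _)).mul_left _).mul_left _)
  have hνs : ∃ l, Tendsto (fun N => ∑ n ∈ Finset.range N, ν n) atTop (𝓝 l) := by
    choose l₁ hl₁ using hn.quad
    choose l₂ hl₂ using hn.cross
    refine ⟨∑ i, ((1 / a) * l₁ i - η * l₂ i), ?_⟩
    have := tendsto_finsetSum Finset.univ fun i _ =>
      ((hl₁ i).const_mul (1 / a)).sub ((hl₂ i).const_mul η)
    refine this.congr fun N => ?_
    rw [hν, Finset.sum_comm]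
    refine Finset.sum_congr rfl fun i _ => ?_
    rw [Finset.sum_sub_distrib, Finset.mul_sum, Finset.mul_sum]
  have hws : ∃ l, Tendsto (fun N => ∑ n ∈ Finset.range N, (ν (n + 1) + E (n + 1))) atTop (𝓝 l) := by
    obtain ⟨l, hl⟩ := hνs
    refine ⟨(l - ν 0) + ∑' n, E (n + 1), ?_⟩
    simp_rw [Finset.sum_add_distrib]
    refine Tendsto.add ?_ ((summable_nat_add_iff 1).2 hEs).hasSum.tendsto_sum_nat
    refine (((tendsto_add_atTop_iff_nat 1).2 hl).sub_const (ν 0)).congr fun N => ?_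
    rw [Finset.sum_range_succ']
    ring
  have hstep : ∀ᶠ n in atTop, lyapunov f μ ε a η β x m v (n + 1) ≤
      lyapunov f μ ε a η β x m v n - η * a / 4 * (γ (n + 1) * ‖g (n + 1)‖ ^ 2) +
        (ν (n + 1) + E (n + 1)) := by
    filter_upwards [(tendsto_add_atTop_nat 1).eventually (hev δ hδ0),
      hp.eventually_norm_x_sub_le hε hs,
      (tendsto_add_atTop_nat 1).eventually
        (hs.tendsto_precondGrowth.eventually_lt_const (show (0 : ℝ) < 1 by norm_num)),
      (tendsto_add_atTop_nat 2).eventually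
        (hs.tendsto_biasCorr_beta.eventually_const_lt (show (0 : ℝ) < 1 by norm_num))]
      with n hk hΔ hκ1 hrb2
    obtain ⟨hA0, hA1, hδ', hθ', hτ, hr, hrb⟩ := hk
    have hγ := hs.pos (n + 1) (by omega)
    have hκ0 : 0 ≤ precondGrowth β (n + 1) := by
      have : 0 ≤ newestWeight β (n + 1) :=
        div_nonneg (by linarith [(hs.beta_mem (n + 1 + 1) (by omega)).2]) hrb2.le
      rw [precondGrowth]; positivity
    set A := 1 - α (n + 1 + 1) with hA
    set κ := precondGrowth β (n + 1) with hκ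
    set q := γ (n + 1) / biasCorr α (n + 1) with hq
    have hcoord : ∀ i, -(q * g (n + 1) i * precond ε β v (n + 1) i * m (n + 1) i) +
        (1 / (2 * a)) * (precond ε β v (n + 1 + 1) i * m (n + 1 + 1) i ^ 2 -
          precond ε β v (n + 1) i * m (n + 1) i ^ 2) -
        η * (A * (g (n + 1) i * (G (n + 1) i - m (n + 1) i))) +
        η * (L * (2 / ε)) * γ (n + 1) * m (n + 1) i ^ 2 ≤
        -(η * a / 4 * γ (n + 1) * g (n + 1) i ^ 2) + ((1 / a) * ((1 + κ) * A *
          precond ε β v (n + 1) i * m (n + 1) i * (G (n + 1) i - g (n + 1) i)) -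
          η * (A * g (n + 1) i * (G (n + 1) i - g (n + 1) i))) +
        (1 + κ) * ε⁻¹ / (2 * a) * (A ^ 2 * (G (n + 1) i - m (n + 1) i) ^ 2) := by
      intro i
      refine lyapunov_step_coord ha hγ hpmin0 ?_ (precond_le hε _ _) hκ0 ?_ (hp.m_succ (n + 1) i)
        hA0 hA1 hδ' hθ' hη0 hθ.le h1 h2 h3
      · rw [hpmin, precond]
        have hv : v (n + 1) i ≤ R :=
          (le_abs_self _).trans ((PiLp.norm_apply_le (v (n + 1)) i).trans (hp.v_le _))
        gcongr
        rw [div_le_iff₀ (by linarith)]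
        nlinarith
      · refine preconditioner_le (β := β (n + 1 + 1)) hε (hp.v_nonneg _ _) (by linarith) hrb2 rfl
          (hs.beta_mem _ (by omega)).2 ?_ rfl hτ
        rw [hp.v_succ (n + 1) i]
        have := mul_nonneg (sub_nonneg.2 (hs.beta_mem (n + 1 + 1) (by omega)).2)
          (sq_nonneg (G (n + 1) i))
        linarith
    have hsum : ∑ i, -(q * g (n + 1) i * precond ε β v (n + 1) i * m (n + 1) i) +
        ∑ i, ((1 / (2 * a)) * (precond ε β v (n + 1 + 1) i * m (n + 1 + 1) i ^ 2 -
          precond ε β v (n + 1) i * m (n + 1) i ^ 2) -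
          η * (A * (g (n + 1) i * (G (n + 1) i - m (n + 1) i)))) +
        η * (L * (2 / ε)) * γ (n + 1) * ∑ i, m (n + 1) i ^ 2 ≤
        ∑ i, -(η * a / 4 * γ (n + 1) * g (n + 1) i ^ 2) + ∑ i, ((1 / a) * ((1 + κ) * A *
          precond ε β v (n + 1) i * m (n + 1) i * (G (n + 1) i - g (n + 1) i)) -
          η * (A * g (n + 1) i * (G (n + 1) i - g (n + 1) i))) +
        ∑ i, (1 + κ) * ε⁻¹ / (2 * a) * (A ^ 2 * (G (n + 1) i - m (n + 1) i) ^ 2) := by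
      rw [Finset.mul_sum]
      simp only [← Finset.sum_add_distrib]
      refine Finset.sum_le_sum fun i _ => (le_of_eq ?_).trans (hcoord i)
      ring
    have hF := hp.descent hε (n := n) hL (hLip _ (hx n) _ (hx (n + 1))).1 hΔ hγ
    have hcross := neg_sum_sub_mul_le hL (hLip _ (hx (n + 1)) _ (hx n)).2 hΔ
    have herr : ∑ i, (1 + κ) * ε⁻¹ / (2 * a) * (A ^ 2 * (G (n + 1) i - m (n + 1) i) ^ 2) ≤
        2 * ε⁻¹ / (2 * a) * ((2 * a) ^ 2 *
          (2 * (γ (n + 1) ^ 2 * ‖G (n + 1)‖ ^ 2) + 2 * R ^ 2 * γ (n + 1) ^ 2)) := by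
      have h4 : ∑ i, (G (n + 1) i - m (n + 1) i) ^ 2 = ‖G (n + 1) - m (n + 1)‖ ^ 2 := by
        rw [EuclideanSpace.real_norm_sq_eq]; simp
      have h5 : ‖G (n + 1) - m (n + 1)‖ ^ 2 ≤ 2 * ‖G (n + 1)‖ ^ 2 + 2 * R ^ 2 := by
        have h6 : ‖G (n + 1) - m (n + 1)‖ ≤ ‖G (n + 1)‖ + R :=
          (norm_sub_le _ _).trans (by gcongr; exact hp.m_le _)
        calc _ ≤ (‖G (n + 1)‖ + R) ^ 2 := by gcongr
          _ ≤ _ := by nlinarith [sq_nonneg (‖G (n + 1)‖ - R)]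
      have hA' : 0 ≤ A := le_trans (by positivity) hA0
      rw [← Finset.mul_sum, ← Finset.mul_sum, h4]
      calc _ ≤ (1 + 1) * ε⁻¹ / (2 * a) * ((2 * a * γ (n + 1)) ^ 2 *
            (2 * ‖G (n + 1)‖ ^ 2 + 2 * R ^ 2)) := by gcongr
        _ = _ := by ring
    have hnorm : ∑ i, -(η * a / 4 * γ (n + 1) * g (n + 1) i ^ 2) =
        -(η * a / 4 * (γ (n + 1) * ‖g (n + 1)‖ ^ 2)) := by
      rw [EuclideanSpace.real_norm_sq_eq, Finset.sum_neg_distrib, ← Finset.mul_sum]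
      ring
    have hdecomp := hp.lyapunov_succ_sub (f := f) (μ := μ) (a := a) (η := η) n
    have hc' := mul_le_mul_of_nonneg_left hcross hη0.le
    have hνn : ν (n + 1) = ∑ i, ((1 / a) * ((1 + κ) * A *
          precond ε β v (n + 1) i * m (n + 1) i * (G (n + 1) i - g (n + 1) i)) -
          η * (A * g (n + 1) i * (G (n + 1) i - g (n + 1) i))) := rfl
    have hEn : E (n + 1) = L * (2 / ε * R) ^ 2 * γ (n + 1) ^ 2 + 2 * ε⁻¹ / (2 * a) *
        ((2 * a) ^ 2 * (2 * (γ (n + 1) ^ 2 * ‖G (n + 1)‖ ^ 2) + 2 * R ^ 2 * γ (n + 1) ^ 2)) := rfl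
    rw [hnorm] at hsum
    linarith only [hsum, hF, hc', herr, hdecomp, hνn, hEn]
  have ht := summable_of_eventually_le_sub
    (t := fun n => η * a / 4 * (γ (n + 1) * ‖g (n + 1)‖ ^ 2)) (fun n => by
      have := hs.pos (n + 1) (by omega)
      positivity) hB hws hstep
  exact (summable_mul_left_iff (by positivity)).1 ht

/-- The gradient vanishes along the trajectory: `∑ γ_n ‖∇F(x_n)‖²` converges, and `∇F(x_n)` moves
by `O(γ_n)`. -/
theorem AdamPath.tendsto_gradient (hp : AdamPath ε R γ α β x m v G) (hε : 0 < ε)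
    (hf : Model f μ) (hmom : LocMoment f μ 4) (hs : Stepsizes γ α β)
    (hn : NoiseConverges f μ ε γ α β x m v G) :
    Tendsto (fun n => gradient (F f μ) (x n)) atTop (𝓝 0) := by
  have hsum := hp.summable_gradient_sq hε hf hmom hs hn
  obtain ⟨L, hL, hLip⟩ := hf.exists_lipschitz_gradient_F hmom R
  have hx : ∀ n, x n ∈ Metric.closedBall (0 : Vec d) R := fun n => by simpa using hp.x_le n
  have hR : 0 ≤ R := (norm_nonneg _).trans (hp.m_le 0)
  have hratio := (tendsto_add_atTop_nat 1).eventually hs.eventually_le_two_mul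
  refine (tendsto_add_atTop_iff_nat 1).1 (tendsto_zero_iff_norm_tendsto_zero.2 ?_)
  refine tendsto_zero_of_summable_mul_sq (γ := fun n => γ (n + 1)) (C := L * (2 / ε * R * 2))
    (fun n => hs.pos _ (by omega)) hs.tendsto_sum_range (fun n => norm_nonneg _) hsum ?_ ?_
  · refine Summable.of_norm_bounded_eventually_nat (g := fun n => 2 * (γ (n + 1 + 1) *
      ‖gradient (F f μ) (x (n + 1 + 1))‖ ^ 2)) (((summable_nat_add_iff 1).2 hsum).mul_left 2) ?_
    filter_upwards [hratio] with n hn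
    have := hs.pos (n + 1) (by omega)
    rw [Real.norm_of_nonneg (by positivity), ← mul_assoc]
    gcongr
    exact hn.2
  · filter_upwards [hratio, (tendsto_add_atTop_nat 1).eventually
      (hp.eventually_norm_x_sub_le hε hs)] with n hn hΔ
    have := hs.pos (n + 1 + 1) (by omega)
    have := hs.pos (n + 1) (by omega)
    calc _ ≤ ‖gradient (F f μ) (x (n + 1 + 1)) - gradient (F f μ) (x (n + 1))‖ :=
          abs_norm_sub_norm_le _ _
      _ ≤ L * ‖x (n + 1 + 1) - x (n + 1)‖ := (hLip _ (hx _) _ (hx _)).2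
      _ ≤ L * (2 / ε * γ (n + 1 + 1) * ‖m (n + 1 + 1)‖) := by gcongr
      _ ≤ L * (2 / ε * (2 * γ (n + 1)) * R) := by
          gcongr
          · exact hn.1
          · exact hp.m_le _
      _ = _ := by ring

theorem tendsto_zero_of_forall_coord {u : ℕ → Vec d}
    (h : ∀ i, Tendsto (fun n => u n i) atTop (𝓝 0)) : Tendsto u atTop (𝓝 0) := by
  have h1 : Tendsto (fun n => (fun i => u n i : Fin d → ℝ)) atTop (𝓝 0) :=
    tendsto_pi_nhds.2 h
  exact ((PiLp.continuous_toLp 2 _).tendsto _).comp h1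

/-- The momentum is an average of the vanishing gradients, up to noise. -/
theorem AdamPath.tendsto_momentum (hp : AdamPath ε R γ α β x m v G) (hε : 0 < ε)
    (hf : Model f μ) (hmom : LocMoment f μ 4) (hs : Stepsizes γ α β)
    (hn : NoiseConverges f μ ε γ α β x m v G) : Tendsto m atTop (𝓝 0) := by
  have hg := hp.tendsto_gradient hε hf hmom hs hn
  obtain ⟨a, b, hb, hab, hα, -⟩ := hs.limits
  refine tendsto_zero_of_forall_coord fun i => ?_
  refine tendsto_zero_of_contraction (a := fun n => 1 - α (n + 1))
    (e := fun n => gradient (F f μ) (x n) i)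
    (fun n => by linarith [(hs.alpha_mem (n + 1) (by omega)).2])
    (fun n => by linarith [(hs.alpha_mem (n + 1) (by omega)).1])
    (hs.tendsto_sum_weights (w := fun n => 1 - α n) (by linarith) hα
      fun n hn => by linarith [(hs.alpha_mem n hn).2])
    ?_ (hn.first i) (Eventually.of_forall fun n => ?_)
  · exact squeeze_zero_norm (fun n => PiLp.norm_apply_le _ i)
      (tendsto_zero_iff_norm_tendsto_zero.1 hg)
  · rw [hp.m_succ]; ring

theorem AdamPath.tendsto_x_sub (hp : AdamPath ε R γ α β x m v G) (hε : 0 < ε)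
    (hs : Stepsizes γ α β) :
    Tendsto (fun n => dist (x (n + 1)) (x n)) atTop (𝓝 0) := by
  have h1 : Tendsto (fun n => 2 / ε * γ (n + 1) * R) atTop (𝓝 0) := by
    simpa using (hs.tendsto_zero.const_mul (2 / ε)).mul_const R
  refine squeeze_zero' (Eventually.of_forall fun n => dist_nonneg) ?_ h1
  filter_upwards [hp.eventually_norm_x_sub_le hε hs] with n hn
  have := hs.pos (n + 1) (by omega)
  rw [dist_eq_norm]
  refine hn.trans ?_
  gcongr
  exact hp.m_le _

/-- The second moment estimate tracks `S(x_n)`, which moves by `o(γ_n)` since the momentum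
vanishes. -/
theorem AdamPath.tendsto_second_moment (hp : AdamPath ε R γ α β x m v G) (hε : 0 < ε)
    (hf : Model f μ) (hmom : LocMoment f μ 4) (hs : Stepsizes γ α β)
    (hn : NoiseConverges f μ ε γ α β x m v G) :
    Tendsto (fun n => S f μ (x n) - v n) atTop (𝓝 0) := by
  have hm := hp.tendsto_momentum hε hf hmom hs hn
  obtain ⟨a, b, hb, hab, -, hβ⟩ := hs.limits
  obtain ⟨L, hL, hLip⟩ := hf.exists_lipschitz_S hmom R
  have hx : ∀ n, x n ∈ Metric.closedBall (0 : Vec d) R := fun n => by simpa using hp.x_le n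
  have hβ1 := (tendsto_add_atTop_iff_nat 1).2 hβ
  have hpos : ∀ᶠ n in atTop, 0 < 1 - β (n + 1) := by
    filter_upwards [hβ1.eventually_const_lt hb] with n hn
    exact (pos_iff_pos_of_mul_pos hn).1 (inv_pos.2 (hs.pos (n + 1) (by omega)))
  refine tendsto_zero_of_forall_coord fun i => ?_
  have key : Tendsto (fun n => v n i - S f μ (x n) i) atTop (𝓝 0) := by
    refine tendsto_zero_of_contraction (a := fun n => 1 - β (n + 1))
      (e := fun n => (S f μ (x n) i - S f μ (x (n + 1)) i) / (1 - β (n + 1)))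
      (fun n => by linarith [(hs.beta_mem (n + 1) (by omega)).2])
      (fun n => by linarith [(hs.beta_mem (n + 1) (by omega)).1])
      (hs.tendsto_sum_weights (w := fun n => 1 - β n) hb hβ
        fun n hn => by linarith [(hs.beta_mem n hn).2])
      ?_ (hn.second i) ?_
    · have h1 : Tendsto (fun n => L * (2 / ε * ((γ (n + 1))⁻¹ * (1 - β (n + 1)))⁻¹ *
          ‖m (n + 1)‖)) atTop (𝓝 0) := by
        have h2 := (tendsto_add_atTop_iff_nat 1).2 (tendsto_zero_iff_norm_tendsto_zero.1 hm)
        simpa using (((hβ1.inv₀ hb.ne').const_mul (2 / ε)).mul h2).const_mul L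
      refine squeeze_zero_norm' ?_ h1
      filter_upwards [hpos, hp.eventually_norm_x_sub_le hε hs] with n hn hΔ
      rw [norm_div, Real.norm_of_nonneg hn.le, div_le_iff₀ hn]
      have := hs.pos (n + 1) (by omega)
      calc _ ≤ L * ‖x n - x (n + 1)‖ := hLip _ (hx _) _ (hx _) i
        _ ≤ L * (2 / ε * γ (n + 1) * ‖m (n + 1)‖) := by rw [norm_sub_rev]; gcongr
        _ = _ := by field_simp
    · filter_upwards [hpos] with n hn
      rw [hp.v_succ, mul_div_cancel₀ _ hn.ne']
      ring
  simpa using key.neg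

theorem AdamPath.tendsto_infDist_crit (hp : AdamPath ε R γ α β x m v G) (hε : 0 < ε)
    (hf : Model f μ) (hmom : LocMoment f μ 4) (hs : Stepsizes γ α β)
    (hn : NoiseConverges f μ ε γ α β x m v G) :
    Tendsto (fun n => Metric.infDist (x n) (crit f μ)) atTop (𝓝 0) :=
  tendsto_infDist_zeros (hf.continuous_gradient_F hmom) (isCompact_closedBall (0 : Vec d) R)
    (fun n => by simpa using hp.x_le n) (hp.tendsto_gradient hε hf hmom hs hn)

theorem AdamPath.exists_tendsto_crit (hp : AdamPath ε R γ α β x m v G) (hε : 0 < ε)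
    (hf : Model f μ) (hmom : LocMoment f μ 4) (hs : Stepsizes γ α β)
    (hn : NoiseConverges f μ ε γ α β x m v G) (hc : (crit f μ).Countable) :
    ∃ y ∈ crit f μ, Tendsto (fun n => (x n, m n, v n)) atTop (𝓝 (y, 0, S f μ y)) := by
  have hg := hp.tendsto_gradient hε hf hmom hs hn
  obtain ⟨y, hy, hxy⟩ := exists_tendsto_of_countable_clusterPts
    (isCompact_closedBall (0 : Vec d) R) (fun n => by simpa using hp.x_le n)
    (hp.tendsto_x_sub hε hs) hc fun y σ hσ hy => tendsto_nhds_unique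
      (((hf.continuous_gradient_F hmom).tendsto y).comp hy) (hg.comp hσ)
  refine ⟨y, hy, hxy.prodMk_nhds ((hp.tendsto_momentum hε hf hmom hs hn).prodMk_nhds ?_)⟩
  have h1 := (((hf.continuous_S hmom).tendsto y).comp hxy).sub
    (hp.tendsto_second_moment hε hf hmom hs hn)
  simpa using h1

end Path

/-! ### Recursions for the iterates -/

section Trajectory

variable {d : ℕ} {Ξ : Type*} {f : Vec d → Ξ → ℝ} {ε R : ℝ} {γ α β : ℕ → ℝ} {x₀ : Vec d}

theorem iter_r (s : ℕ → Ξ) (n : ℕ) : (iter f ε γ α β x₀ s n).r = biasCorr α n := by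
  induction n with
  | zero => rfl
  | succ n ih => simp [iter, step, biasCorr, ih]

theorem iter_rbar (s : ℕ → Ξ) (n : ℕ) : (iter f ε γ α β x₀ s n).rbar = biasCorr β n := by
  induction n with
  | zero => rfl
  | succ n ih => simp [iter, step, biasCorr, ih]

theorem iter_m_succ (s : ℕ → Ξ) (n : ℕ) (i : Fin d) :
    (iter f ε γ α β x₀ s (n + 1)).m i = (iter f ε γ α β x₀ s n).m i + (1 - α (n + 1)) *
      (grad f (iter f ε γ α β x₀ s n).x (s (n + 1)) i - (iter f ε γ α β x₀ s n).m i) := by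
  simp only [iter, step, PiLp.add_apply, PiLp.smul_apply, smul_eq_mul]
  ring

theorem iter_v_succ (s : ℕ → Ξ) (n : ℕ) (i : Fin d) :
    (iter f ε γ α β x₀ s (n + 1)).v i = (iter f ε γ α β x₀ s n).v i + (1 - β (n + 1)) *
      (grad f (iter f ε γ α β x₀ s n).x (s (n + 1)) i ^ 2 - (iter f ε γ α β x₀ s n).v i) := by
  simp only [iter, step, PiLp.add_apply, PiLp.smul_apply, smul_eq_mul]
  ring

theorem iter_x_succ (s : ℕ → Ξ) (n : ℕ) (i : Fin d) :
    (iter f ε γ α β x₀ s (n + 1)).x i = (iter f ε γ α β x₀ s n).x i -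
      γ (n + 1) / biasCorr α (n + 1) *
        precond ε β (fun n => (iter f ε γ α β x₀ s n).v) (n + 1) i *
        (iter f ε γ α β x₀ s (n + 1)).m i := by
  rw [precond, ← iter_r (f := f) (ε := ε) (γ := γ) (β := β) (x₀ := x₀) s (n + 1),
    ← iter_rbar (f := f) (ε := ε) (γ := γ) (α := α) (x₀ := x₀) s (n + 1)]
  simp only [iter, step, div_eq_mul_inv]
  ring

theorem iter_v_nonneg (hβ : ∀ n ≥ 1, 0 ≤ β n ∧ β n ≤ 1) (s : ℕ → Ξ) (n : ℕ) (i : Fin d) :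
    0 ≤ (iter f ε γ α β x₀ s n).v i := by
  induction n with
  | zero => simp [iter]
  | succ n ih =>
    obtain ⟨h0, h1⟩ := hβ (n + 1) (by omega)
    have h2 := mul_nonneg (sub_nonneg.2 h1)
      (sq_nonneg (grad f (iter f ε γ α β x₀ s n).x (s (n + 1)) i))
    rw [iter_v_succ]
    nlinarith [mul_nonneg h0 ih]

theorem adamPath_iter (hβ : ∀ n ≥ 1, 0 ≤ β n ∧ β n ≤ 1) {s : ℕ → Ξ}
    (h : ∀ n, ‖triple f ε γ α β x₀ s n‖ ≤ R) :
    AdamPath ε R γ α β (fun n => (iter f ε γ α β x₀ s n).x) (fun n => (iter f ε γ α β x₀ s n).m)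
      (fun n => (iter f ε γ α β x₀ s n).v)
      (fun n => grad f (iter f ε γ α β x₀ s n).x (s (n + 1))) where
  x_succ := iter_x_succ s
  m_succ := iter_m_succ s
  v_succ := iter_v_succ s
  v_nonneg := iter_v_nonneg hβ s
  x_le n := (norm_fst_le _).trans (h n)
  m_le n := (norm_fst_le _).trans ((norm_snd_le (triple f ε γ α β x₀ s n)).trans (h n))
  v_le n := (norm_snd_le _).trans ((norm_snd_le (triple f ε γ α β x₀ s n)).trans (h n))

end Trajectory

/-! ### Randomness -/

section Probability

variable {Ω Ξ : Type*} {mΩ : MeasurableSpace Ω} [MeasurableSpace Ξ] {P : Measure Ω}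
  {μ : Measure Ξ} {ξ : ℕ → Ω → Ξ}

/-- The filtration generated by the samples: stage `n` knows `ξ 1, …, ξ n`. -/
def sampleFiltration (hξ : ∀ n ≥ 1, Measurable (ξ n)) : Filtration ℕ mΩ where
  seq n := ⨆ k ∈ Set.Iio n, MeasurableSpace.comap (ξ (k + 1)) inferInstance
  mono' _ _ h := biSup_mono fun _ hk => lt_of_lt_of_le hk h
  le' _ := iSup₂_le fun k _ => (hξ (k + 1) (by omega)).comap_le

theorem measurable_sample (hξ : ∀ n ≥ 1, Measurable (ξ n)) (n : ℕ) :
    Measurable[sampleFiltration hξ (n + 1)] (ξ (n + 1)) := by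
  refine Measurable.of_comap_le ?_
  exact le_iSup₂ (f := fun k (_ : k ∈ Set.Iio (n + 1)) =>
    MeasurableSpace.comap (ξ (k + 1)) inferInstance) n (Set.mem_Iio.2 n.lt_succ_self)

theorem IsIIDSample.indep_sampleFiltration (h : IsIIDSample P μ ξ) (n : ℕ) :
    Indep (sampleFiltration h.measurable n)
      (MeasurableSpace.comap (ξ (n + 1)) inferInstance) P := by
  have h1 := indep_iSup_of_disjoint
    (m := fun k => MeasurableSpace.comap (ξ (k + 1)) inferInstance)
    (fun k => (h.measurable (k + 1) (by omega)).comap_le) h.indep.iIndep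
    (S := Set.Iio n) (T := {n}) (by simp)
  rw [iSup_singleton] at h1
  exact h1

variable {d : ℕ} {f : Vec d → Ξ → ℝ} {ε : ℝ} {γ α β : ℕ → ℝ} {x₀ : Vec d}

theorem measurable_iter (hf : Model f μ) (hξ : ∀ n ≥ 1, Measurable (ξ n)) (n : ℕ) :
    Measurable[sampleFiltration hξ n] (fun ω => (iter f ε γ α β x₀ (fun k => ξ k ω) n).x) ∧
    Measurable[sampleFiltration hξ n] (fun ω => (iter f ε γ α β x₀ (fun k => ξ k ω) n).m) ∧
    Measurable[sampleFiltration hξ n] (fun ω => (iter f ε γ α β x₀ (fun k => ξ k ω) n).v) := by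
  induction n with
  | zero => exact ⟨measurable_const, measurable_const, measurable_const⟩
  | succ n ih =>
    obtain ⟨hx, hm, hv⟩ := ih
    have hle := (sampleFiltration hξ).mono n.le_succ
    replace hx := hx.mono hle le_rfl
    replace hm := hm.mono hle le_rfl
    replace hv := hv.mono hle le_rfl
    have hG : Measurable[sampleFiltration hξ (n + 1)] (fun ω =>
        grad f (iter f ε γ α β x₀ (fun k => ξ k ω) n).x (ξ (n + 1) ω)) :=
      hf.measurable_grad.comp (hx.prodMk (measurable_sample hξ n))
    have hcoord : ∀ {u : Ω → Vec d} (i : Fin d), Measurable[sampleFiltration hξ (n + 1)] u →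
        Measurable[sampleFiltration hξ (n + 1)] fun ω => u ω i := fun i hu =>
      ((measurable_pi_apply i).comp (WithLp.measurable_ofLp 2 _)).comp hu
    have hvec : ∀ {u : Ω → Vec d},
        (∀ i, Measurable[sampleFiltration hξ (n + 1)] fun ω => u ω i) →
        Measurable[sampleFiltration hξ (n + 1)] u := fun {u} hu =>
      (WithLp.measurable_toLp 2 _).comp (g := WithLp.toLp 2) (f := fun ω i => u ω i)
        (@measurable_pi_lambda _ _ _ (sampleFiltration hξ (n + 1)) _ _ hu)
    have hm' : Measurable[sampleFiltration hξ (n + 1)]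
        (fun ω => (iter f ε γ α β x₀ (fun k => ξ k ω) (n + 1)).m) := by
      refine hvec fun i => ?_
      simp_rw [iter_m_succ]
      exact (hcoord i hm).add (((hcoord i hG).sub (hcoord i hm)).const_mul _)
    have hv' : Measurable[sampleFiltration hξ (n + 1)]
        (fun ω => (iter f ε γ α β x₀ (fun k => ξ k ω) (n + 1)).v) := by
      refine hvec fun i => ?_
      simp_rw [iter_v_succ]
      exact (hcoord i hv).add ((((hcoord i hG).pow_const 2).sub (hcoord i hv)).const_mul _)
    refine ⟨hvec fun i => ?_, hm', hv'⟩
    simp_rw [iter_x_succ]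
    refine (hcoord i hx).sub (Measurable.mul (Measurable.const_mul ?_ _) (hcoord i hm'))
    simp only [precond]
    exact (((hcoord i hv').div_const _).sqrt.const_add ε).inv

variable [IsProbabilityMeasure P] [IsProbabilityMeasure μ]

/-- Almost sure convergence of a series of centred noise terms, on the event that the trajectory
stays in the sets `A n` on which the moments and the weights are controlled. -/
theorem IsIIDSample.ae_exists_tendsto (h : IsIIDSample P μ ξ) {X : ℕ → Ω → Vec d}
    (hX : ∀ n, Measurable[sampleFiltration h.measurable n] (X n)) {A : ℕ → Set Ω}
    (hA : ∀ n, MeasurableSet[sampleFiltration h.measurable n] (A n)) {R : ℝ}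
    (hAX : ∀ n, ∀ ω ∈ A n, ‖X n ω‖ ≤ R) {w : ℕ → Ω → ℝ}
    (hw : ∀ n, Measurable[sampleFiltration h.measurable n] (w n)) {c : ℕ → ℝ}
    (hwc : ∀ n, ∀ ω ∈ A n, |w n ω| ≤ c n) (hc : Summable fun n => c n ^ 2)
    {u : Vec d → Ξ → ℝ} (hu : Measurable fun q : Vec d × Ξ => u q.1 q.2) {C : ℝ≥0∞} (hC : C < ∞)
    (hu2 : ∀ x ∈ Metric.closedBall (0 : Vec d) R, ∫⁻ s, ‖u x s‖ₑ ^ 2 ∂μ ≤ C) :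
    ∀ᵐ ω ∂P, (∀ n, ω ∈ A n) → ∃ l, Tendsto (fun N => ∑ n ∈ Finset.range N,
      w n ω * (u (X n ω) (ξ (n + 1) ω) - ∫ s, u (X n ω) s ∂μ)) atTop (𝓝 l) := by
  classical
  have humeas : ∀ x, Measurable (u x) := fun x => hu.comp measurable_prodMk_left
  have hL : ∀ x ∈ Metric.closedBall (0 : Vec d) R, MemLp (u x) 2 μ := fun x hx => by
    refine ⟨(humeas x).aestronglyMeasurable, ?_⟩
    rw [eLpNorm_lt_top_iff_lintegral_rpow_enorm_lt_top (by norm_num) (by norm_num)]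
    simpa using (hu2 x hx).trans_lt hC
  have hmean : Measurable fun x => ∫ s, u x s ∂μ :=
    (hu.stronglyMeasurable.integral_prod_right' (ν := μ)).measurable
  -- Truncation to the ball makes the moment bounds hold everywhere.
  set g : Vec d → Ξ → ℝ := fun x s =>
    if x ∈ Metric.closedBall (0 : Vec d) R then u x s - ∫ s, u x s ∂μ else 0 with hg
  have hgm : Measurable fun q : Vec d × Ξ => g q.1 q.2 := by
    refine Measurable.ite ?_ (hu.sub (hmean.comp measurable_fst)) measurable_const
    exact measurable_fst Metric.isClosed_closedBall.measurableSet
  have hg0 : ∀ x, ∫ s, g x s ∂μ = 0 := by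
    intro x
    by_cases hx : x ∈ Metric.closedBall (0 : Vec d) R
    · simp only [hg, if_pos hx]
      rw [integral_sub ((hL x hx).integrable (by norm_num)) (integrable_const _)]
      simp
    · simp only [hg, if_neg hx]; simp
  have hg2 : ∀ x, ∫⁻ s, ‖g x s‖ₑ ^ 2 ∂μ ≤ C := by
    intro x
    by_cases hx : x ∈ Metric.closedBall (0 : Vec d) R
    · simp only [hg, if_pos hx]
      change evariance (u x) μ ≤ C
      rw [← (hL x hx).ofReal_variance_eq]
      refine le_trans ?_ (hu2 x hx)
      refine (ENNReal.ofReal_le_ofReal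
        (variance_le_expectation_sq (humeas x).aestronglyMeasurable)).trans (le_of_eq ?_)
      rw [ofReal_integral_eq_lintegral_ofReal (f := u x ^ 2) (hL x hx).integrable_sq
        (Eventually.of_forall fun s => sq_nonneg _)]
      refine lintegral_congr fun s => ?_
      rw [← ofReal_norm, ← ENNReal.ofReal_pow (norm_nonneg _), Real.norm_eq_abs, sq_abs]
      rfl
    · simp only [hg, if_neg hx]; simp
  have key := ae_exists_tendsto_noise (P := P) (μ := μ) hX (ζ := fun n => ξ (n + 1))
    (measurable_sample h.measurable) (fun n => h.map_eq (n + 1) (by omega))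
    h.indep_sampleFiltration (w := fun n => (A n).indicator (w n))
    (fun n => (hw n).indicator (hA n)) (c := fun n => |c n|) (fun n ω => ?_)
    (by simpa only [sq_abs] using hc) hgm hg0 hC hg2
  · filter_upwards [key] with ω hω hAω
    obtain ⟨l, hl⟩ := hω
    refine ⟨l, hl.congr fun N => Finset.sum_congr rfl fun n _ => ?_⟩
    have : X n ω ∈ Metric.closedBall (0 : Vec d) R := by simpa using hAX n ω (hAω n)
    rw [Set.indicator_of_mem (hAω n)]
    simp only [hg, if_pos this]
  · by_cases hω : ω ∈ A n
    · rw [Set.indicator_of_mem hω]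
      exact (hwc n ω hω).trans (le_abs_self _)
    · rw [Set.indicator_of_notMem hω]
      simp

theorem Model.gradient_F_apply (hf : Model f μ) (hmom : LocMoment f μ 4) (x : Vec d) (i : Fin d) :
    gradient (F f μ) x i = ∫ s, grad f x s i ∂μ := by
  rw [hf.gradient_F hmom]
  exact ((EuclideanSpace.proj i : Vec d →L[ℝ] ℝ).integral_comp_comm
    (hf.integrable_grad hmom x)).symm

/-- All the noise series converge almost surely on the event that the trajectory is bounded
by `R`. -/
theorem IsIIDSample.ae_noiseConverges (h : IsIIDSample P μ ξ) (hε : 0 < ε) (hf : Model f μ)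
    (hmom : LocMoment f μ 4) (hs : Stepsizes γ α β) (R : ℝ) :
    ∀ᵐ ω ∂P, (∀ n, ‖triple f ε γ α β x₀ (fun k => ξ k ω) n‖ ≤ R) →
      NoiseConverges f μ ε γ α β (fun n => (iter f ε γ α β x₀ (fun k => ξ k ω) n).x)
        (fun n => (iter f ε γ α β x₀ (fun k => ξ k ω) n).m)
        (fun n => (iter f ε γ α β x₀ (fun k => ξ k ω) n).v)
        (fun n => grad f (iter f ε γ α β x₀ (fun k => ξ k ω) n).x (ξ (n + 1) ω)) := by
  classical
  set X : ℕ → Ω → Vec d := fun n ω => (iter f ε γ α β x₀ (fun k => ξ k ω) n).x with hXdef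
  set M : ℕ → Ω → Vec d := fun n ω => (iter f ε γ α β x₀ (fun k => ξ k ω) n).m with hMdef
  set V : ℕ → Ω → Vec d := fun n ω => (iter f ε γ α β x₀ (fun k => ξ k ω) n).v with hVdef
  set ℱ := sampleFiltration h.measurable with hℱ
  have hX : ∀ n, Measurable[ℱ n] (X n) := fun n => (measurable_iter hf h.measurable n).1
  have hM : ∀ n, Measurable[ℱ n] (M n) := fun n => (measurable_iter hf h.measurable n).2.1
  have hV : ∀ n, Measurable[ℱ n] (V n) := fun n => (measurable_iter hf h.measurable n).2.2
  have hcoord : ∀ {n : ℕ} {u : Ω → Vec d} (i : Fin d), Measurable[ℱ n] u →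
      Measurable[ℱ n] fun ω => u ω i := fun i hu =>
    ((measurable_pi_apply i).comp (WithLp.measurable_ofLp 2 _)).comp hu
  set A : ℕ → Set Ω := fun n => {ω | ‖X n ω‖ ≤ R ∧ ‖M n ω‖ ≤ R} with hAdef
  have hA : ∀ n, MeasurableSet[ℱ n] (A n) := fun n => by
    have h1 : MeasurableSet[ℱ n] (X n ⁻¹' Metric.closedBall 0 R) :=
      hX n Metric.isClosed_closedBall.measurableSet
    have h2 : MeasurableSet[ℱ n] (M n ⁻¹' Metric.closedBall 0 R) :=
      hM n Metric.isClosed_closedBall.measurableSet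
    convert h1.inter h2 using 1
    ext ω
    simp [hAdef]
  have hAX : ∀ n, ∀ ω ∈ A n, ‖X n ω‖ ≤ R := fun n ω hω => hω.1
  obtain ⟨a, b, hb, hab, hα, hβ⟩ := hs.limits
  have hα1 := (tendsto_add_atTop_iff_nat 1).2 hα
  have hβ1 := (tendsto_add_atTop_iff_nat 1).2 hβ
  have hαsq : Summable fun n => (1 - α (n + 1)) ^ 2 := hs.summable_sq_weights hα1
  have hβsq : Summable fun n => (1 - β (n + 1)) ^ 2 := hs.summable_sq_weights hβ1
  have hα0 : ∀ n, 0 ≤ 1 - α (n + 1) := fun n => by linarith [(hs.alpha_mem (n + 1) (by omega)).2]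
  have hβ0 : ∀ n, 0 ≤ 1 - β (n + 1) := fun n => by linarith [(hs.beta_mem (n + 1) (by omega)).2]
  have hκsq : Summable fun n => ((1 + precondGrowth β n) * (1 - α (n + 1))) ^ 2 := by
    refine hs.summable_sq_weights (c := (1 + 0) * a)
      (((hs.tendsto_precondGrowth.const_add 1).mul hα1).congr fun n => ?_)
    ring
  obtain ⟨C₂, hC₂, hb₂⟩ := hmom.exists_bound_sq R
  obtain ⟨C₄, hC₄, hb₄⟩ := hmom.exists_bound R
  obtain ⟨B, hB⟩ := (isCompact_closedBall (0 : Vec d) R).exists_bound_of_continuousOn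
    (hf.continuous_gradient_F hmom).continuousOn
  have hgi : ∀ i, Measurable fun q : Vec d × Ξ => grad f q.1 q.2 i := fun i =>
    ((measurable_pi_apply i).comp (WithLp.measurable_ofLp 2 _)).comp hf.measurable_grad
  have hle : ∀ (x : Vec d) s i, ‖grad f x s i‖ₑ ≤ ‖grad f x s‖ₑ := fun x s i => by
    rw [← ofReal_norm, ← ofReal_norm]
    exact ENNReal.ofReal_le_ofReal (PiLp.norm_apply_le _ i)
  have hm₂ : ∀ i, ∀ x ∈ Metric.closedBall (0 : Vec d) R,
      ∫⁻ s, ‖grad f x s i‖ₑ ^ 2 ∂μ ≤ C₂ := fun i x hx =>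
    (lintegral_mono fun s => by gcongr; exact hle x s i).trans (hb₂ x hx)
  have hm₄ : ∀ i, ∀ x ∈ Metric.closedBall (0 : Vec d) R,
      ∫⁻ s, ‖grad f x s i ^ 2‖ₑ ^ 2 ∂μ ≤ C₄ := fun i x hx =>
    (lintegral_mono fun s => by
      rw [enorm_pow, ← pow_mul]
      gcongr
      exact hle x s i).trans (hb₄ x hx)
  have e₁ : ∀ᵐ ω ∂P, ∀ i, (∀ n, ω ∈ A n) → _ := ae_all_iff.2 fun i =>
    h.ae_exists_tendsto hX hA hAX (w := fun n _ => 1 - α (n + 1)) (fun n => measurable_const)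
      (c := fun n => 1 - α (n + 1)) (fun n ω _ => (abs_of_nonneg (hα0 n)).le) hαsq (hgi i) hC₂
      (hm₂ i)
  have e₂ : ∀ᵐ ω ∂P, ∀ i, (∀ n, ω ∈ A n) → _ := ae_all_iff.2 fun i =>
    h.ae_exists_tendsto hX hA hAX (w := fun n _ => 1 - β (n + 1)) (fun n => measurable_const)
      (c := fun n => 1 - β (n + 1)) (fun n ω _ => (abs_of_nonneg (hβ0 n)).le) hβsq
      (u := fun x s => grad f x s i ^ 2) ((hgi i).pow_const 2) hC₄ (hm₄ i)
  have e₃ : ∀ᵐ ω ∂P, ∀ i, (∀ n, ω ∈ A n) → _ := ae_all_iff.2 fun i =>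
    h.ae_exists_tendsto hX hA hAX (w := fun n ω => (1 + precondGrowth β n) * (1 - α (n + 1)) *
        precond ε β (fun n => V n ω) n i * M n ω i)
      (fun n => ?_) (c := fun n => |(1 + precondGrowth β n) * (1 - α (n + 1))| * (ε⁻¹ * R))
      (fun n ω hω => ?_) ?_ (hgi i) hC₂ (hm₂ i)
  rotate_left
  · refine Measurable.mul (Measurable.const_mul ?_ _) (hcoord i (hM n))
    simp only [precond]
    exact (((hcoord i (hV n)).div_const _).sqrt.const_add ε).inv
  · rw [mul_assoc _ _ (M n ω i), abs_mul, abs_mul (precond _ _ _ _ _),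
      abs_of_nonneg (precond_nonneg hε n i)]
    have h1 : |M n ω i| ≤ R := (PiLp.norm_apply_le (M n ω) i).trans hω.2
    gcongr
    exact precond_le hε n i
  · simp only [mul_pow _ (ε⁻¹ * R), sq_abs]
    exact hκsq.mul_right _
  have e₄ : ∀ᵐ ω ∂P, ∀ i, (∀ n, ω ∈ A n) → _ := ae_all_iff.2 fun i =>
    h.ae_exists_tendsto hX hA hAX (w := fun n ω => (1 - α (n + 1)) * gradient (F f μ) (X n ω) i)
      (fun n => (hcoord i ((hf.continuous_gradient_F hmom).measurable.comp (hX n))).const_mul _)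
      (c := fun n => (1 - α (n + 1)) * B) (fun n ω hω => ?_)
      (by simpa only [mul_pow] using hαsq.mul_right _) (hgi i) hC₂ (hm₂ i)
  rotate_left
  · rw [abs_mul, abs_of_nonneg (hα0 n)]
    gcongr
    · exact hα0 n
    · exact (PiLp.norm_apply_le (gradient (F f μ) (X n ω)) i).trans (hB _ (by simpa using hω.1))
  have e₅ := ae_summable_of_lintegral_le (P := P) (μ := μ) hX (ζ := fun n => ξ (n + 1))
    (fun n => h.measurable (n + 1) (by omega)) (fun n => h.map_eq (n + 1) (by omega))
    h.indep_sampleFiltration (c := fun n => γ n ^ 2) (fun n => sq_nonneg _)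
    ((summable_nat_add_iff 1).1 hs.summable_sq)
    (h := fun x s => if x ∈ Metric.closedBall (0 : Vec d) R then ‖grad f x s‖ ^ 2 else 0)
    (Measurable.ite (measurable_fst Metric.isClosed_closedBall.measurableSet)
      (hf.measurable_grad.norm.pow_const 2) measurable_const)
    (fun x s => by positivity) hC₂ (fun x => ?_)
  rotate_left
  · by_cases hx : x ∈ Metric.closedBall (0 : Vec d) R
    · simp only [if_pos hx]
      refine le_trans (le_of_eq (lintegral_congr fun s => ?_)) (hb₂ x hx)
      rw [ENNReal.ofReal_pow (norm_nonneg _), ofReal_norm]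
    · simp only [if_neg hx]; simp
  filter_upwards [e₁, e₂, e₃, e₄, e₅] with ω h₁ h₂ h₃ h₄ h₅ hbd
  have hAω : ∀ n, ω ∈ A n := fun n => ⟨(norm_fst_le _).trans (hbd n),
    (norm_fst_le _).trans ((norm_snd_le (triple f ε γ α β x₀ (fun k => ξ k ω) n)).trans (hbd n))⟩
  refine ⟨fun i => ?_, fun i => h₂ i hAω, fun i => ?_, fun i => ?_, ?_⟩
  · simpa only [hf.gradient_F_apply hmom] using h₁ i hAω
  · simpa only [hf.gradient_F_apply hmom] using h₃ i hAω
  · simpa only [hf.gradient_F_apply hmom] using h₄ i hAω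
  · refine h₅.congr fun n => ?_
    rw [if_pos (by simpa using (hAω n).1)]

end Probability

end DecrAdam

theorem mainTheorem5 {Ω Ξ : Type*} [MeasurableSpace Ω] [MeasurableSpace Ξ]
    (P : Measure Ω) [IsProbabilityMeasure P] (μ : Measure Ξ) [IsProbabilityMeasure μ]
    (d : ℕ) (f : DecrAdam.Vec d → Ξ → ℝ) (ξ : ℕ → Ω → Ξ)
    (ε : ℝ) (hε : 0 < ε) (γ α β : ℕ → ℝ) (x₀ : DecrAdam.Vec d)
    (hmodel : DecrAdam.Model f μ)
    (hcoercive : Tendsto (DecrAdam.F f μ) (Bornology.cobounded (DecrAdam.Vec d)) atTop)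
    (hSpos : ∀ x i, 0 < DecrAdam.S f μ x i)
    (hiid : DecrAdam.IsIIDSample P μ ξ)
    (hstep : DecrAdam.Stepsizes γ α β)
    (hmoment : DecrAdam.LocMoment f μ 4)
    (hcrit : interior (DecrAdam.F f μ '' DecrAdam.crit f μ) = ∅)
    (hbdd : ∀ᵐ ω ∂P, Bornology.IsBounded
      (Set.range (DecrAdam.triple f ε γ α β x₀ (fun n => ξ n ω)))) :
    (DecrAdam.crit f μ).Nonempty ∧
    (∀ᵐ ω ∂P,
      Tendsto (fun n => Metric.infDist (DecrAdam.iter f ε γ α β x₀ (fun k => ξ k ω) n).x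
        (DecrAdam.crit f μ)) atTop (𝓝 0) ∧
      Tendsto (fun n => (DecrAdam.iter f ε γ α β x₀ (fun k => ξ k ω) n).m) atTop (𝓝 0) ∧
      Tendsto (fun n => DecrAdam.S f μ (DecrAdam.iter f ε γ α β x₀ (fun k => ξ k ω) n).x
        - (DecrAdam.iter f ε γ α β x₀ (fun k => ξ k ω) n).v) atTop (𝓝 0)) ∧
    ((DecrAdam.crit f μ).Countable →
      ∀ᵐ ω ∂P, ∃ x' ∈ DecrAdam.crit f μ,
        Tendsto (DecrAdam.triple f ε γ α β x₀ (fun n => ξ n ω)) atTop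
          (𝓝 (x', 0, DecrAdam.S f μ x'))) := by
  -- Almost surely, the trajectory is bounded by some natural number, and the noise series converge.
  have hgood := (ae_all_iff.2 fun N : ℕ =>
    hiid.ae_noiseConverges (x₀ := x₀) hε hmodel hmoment hstep (N : ℝ)).and hbdd
  have hpath : ∀ᵐ ω ∂P, ∃ R : ℝ,
      DecrAdam.AdamPath ε R γ α β
        (fun n => (DecrAdam.iter f ε γ α β x₀ (fun k => ξ k ω) n).x)
        (fun n => (DecrAdam.iter f ε γ α β x₀ (fun k => ξ k ω) n).m)
        (fun n => (DecrAdam.iter f ε γ α β x₀ (fun k => ξ k ω) n).v)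
        (fun n => DecrAdam.grad f (DecrAdam.iter f ε γ α β x₀ (fun k => ξ k ω) n).x
          (ξ (n + 1) ω)) ∧
      DecrAdam.NoiseConverges f μ ε γ α β
        (fun n => (DecrAdam.iter f ε γ α β x₀ (fun k => ξ k ω) n).x)
        (fun n => (DecrAdam.iter f ε γ α β x₀ (fun k => ξ k ω) n).m)
        (fun n => (DecrAdam.iter f ε γ α β x₀ (fun k => ξ k ω) n).v)
        (fun n => DecrAdam.grad f (DecrAdam.iter f ε γ α β x₀ (fun k => ξ k ω) n).x
          (ξ (n + 1) ω)) := by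
    filter_upwards [hgood] with ω hω
    obtain ⟨hnoise, hb⟩ := hω
    obtain ⟨C, hC⟩ := hb.exists_norm_le
    obtain ⟨N, hN⟩ := exists_nat_ge C
    have hle : ∀ n, ‖DecrAdam.triple f ε γ α β x₀ (fun k => ξ k ω) n‖ ≤ N :=
      fun n => (hC _ ⟨n, rfl⟩).trans hN
    exact ⟨N, DecrAdam.adamPath_iter (s := fun k => ξ k ω) hstep.beta_mem hle, hnoise N hle⟩
  refine ⟨hmodel.crit_nonempty hmoment hcoercive, ?_, fun hcount => ?_⟩
  · filter_upwards [hpath] with ω ⟨R, hp, hn⟩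
    exact ⟨hp.tendsto_infDist_crit hε hmodel hmoment hstep hn,
      hp.tendsto_momentum hε hmodel hmoment hstep hn,
      hp.tendsto_second_moment hε hmodel hmoment hstep hn⟩
  · filter_upwards [hpath] with ω ⟨R, hp, hn⟩
    exact hp.exists_tendsto_crit hε hmodel hmoment hstep hn hcount
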